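/- \textbf{Definitions.} Let $G$ be a Lie group with Lie algebra $\mathfrak g$. For a $G$-manifold $M$ and $\xi\in\mathfrak g$ write $\xi_M(x)=\frac{d}{dt}\big|_{t=0}\exp(t\xi)\cdot x$. A \emph{premoment space} for $G$ is a $G$-manifold $P$ with a closed equivariant three-form $\Xi+\tau$, that is, an invariant form $\Xi\in\Omega^3(P)^G$ and a linear map $\tau:\mathfrak g\to\Omega^1(P)$ with $\tau(\mathrm{Ad}_g\xi)=(g^{-1})^*\tau(\xi)$, such that $d\Xi=0$, $\iota_\xi\Xi=d\tau(\xi)$ and $\iota_\xi\tau(\xi)=0$ for all $\xi\in\mathfrak g$, $g\in G$. Put $\tau_p:\mathfrak g\to T_p^*P$, $\xi\mapsto\tau(\xi)_p$. A $G$-manifold $M$ with an invariant two-form $\omega$ and a smooth equivariant map $\Phi:M\to P$ is \emph{$P$-Hamiltonian} if $d\omega=-\Phi^*\Xi$, $\iota(\xi_M)\omega=\Phi^*\tau(\xi)$ for all $\xi\in\mathfrak g$, and $$\ker\omega_x=\{\xi_M(x):\xi\in\ker\tau_{\Phi(x)}\}\qquad\text{for all }x\in M.$$ Each $G$-orbit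 $\mathcal O\subset P$ carries its manifold structure as a homogeneous space of $G$. $P$ is a \emph{moment space} for $G$ if on every orbit $\mathcal O$ there is a (unique) two-form $\omega_{\mathcal O}$ with $\omega_{\mathcal O}(\xi_P(p),\eta_P(p))=\tau(\xi)_p(\eta_P(p))$ for all $p\in\mathcal O$ and $\xi,\eta\in\mathfrak g$, and $\mathcal O$ with $\omega_{\mathcal O}$ and the inclusion $\mathcal O\to P$ as moment map is $P$-Hamiltonian. A \emph{symmetric pair} $(H,G)$ is a Lie group $H$ with a closed subgroup $G$ and an involutive automorphism $\sigma\ne\mathrm{id}$ of $H$ such that $(H^\sigma)_0\subseteq G\subseteq H^\sigma$. Let $\mathfrak h$ be the Lie algebra of $H$ and $s=d\sigma_e$. The pair is \emph{Legendrian} if $\mathfrak h$ is given a nondegenerate symmetric bilinear form $\Lambda$ with $\Lambda(sx,y)=-\Lambda(x,sy)$ that is invariant under the adjoint actions of $\mathfrak h$ and of $H$. \textbf{Theorem.} Let $(H,G)$ be a Legendrian symmetric pair (with $H$ a finite-dimensional real Lie group), let $P=H/G$ with its left $G$-action and its manifold structure as a homogeneous space, and let $j:H\to P$ be the quotient map.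 Let $\theta$ be the left-invariant Maurer--Cartan form of $H$ and $\pi=\frac{1-s}{2}\theta$. Then there are a unique three-form $\Xi$ and a unique linear map $\tau:\mathfrak g\to\Omega^1(P)$ with $$j^*\Xi=\tfrac13\Lambda(\pi,[\pi,\pi]),\qquad (j^*\tau(\xi))_h=\Lambda(\xi,\mathrm{Ad}_h\pi)\quad(\xi\in\mathfrak g,\ h\in H),$$ where products of forms are wedge products, so $[\pi,\pi](u,v)=2[\pi(u),\pi(v)]$. With $\Xi+\tau$, $P$ is a moment space for $G$. In particular $\ker(\omega_{\mathcal O})_p=\{\xi_P(p):\xi\in\ker\tau_p\}$ for every orbit $\mathcal O$ and every $p\in\mathcal O$, and every orbit is $P$-Hamiltonian. -/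

import Mathlib

open scoped Manifold ContDiff

noncomputable section

namespace MomentSpace

/-! ## Differential forms on a manifold -/

section Forms

variable {E : Type*} [NormedAddCommGroup E] [NormedSpace ℝ E]
  {M : Type*} [TopologicalSpace M] [ChartedSpace E M]
  {E' : Type*} [NormedAddCommGroup E'] [NormedSpace ℝ E']
  {N : Type*} [TopologicalSpace N] [ChartedSpace E' N]
  {k : ℕ}

/-- Differential `k`-forms on a manifold `M` modelled on `E`, not necessarily smooth: an alternating
`k`-linear form on each tangent space. Smoothness is the separate predicate `IsSmoothForm`. -/
abbrev DiffForm (E : Type*) [NormedAddCommGroup E] [NormedSpace ℝ E]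
    (M : Type*) [TopologicalSpace M] [ChartedSpace E M] (k : ℕ) : Type _ :=
  ∀ x : M, (TangentSpace 𝓘(ℝ, E) x) [⋀^Fin k]→L[ℝ] ℝ

/-- The pullback `f^* α`. -/
def pullback (f : M → N) (α : DiffForm E' N k) : DiffForm E M k := fun x =>
  (α (f x)).compContinuousLinearMap (mfderiv 𝓘(ℝ, E) 𝓘(ℝ, E') f x)

/-- The form `α` read in the preferred chart at `x₀`: its pullback under the inverse chart, as a
form on the model space (meaningful on the target of the chart). -/
def chartRep (α : DiffForm E M k) (x₀ : M) : E → E [⋀^Fin k]→L[ℝ] ℝ := fun y =>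
  (α ((chartAt E x₀).symm y)).compContinuousLinearMap
    (mfderiv 𝓘(ℝ, E) 𝓘(ℝ, E) (chartAt E x₀).symm y)

/-- A form is smooth if it is smooth when read in each of the preferred charts, which cover `M`. -/
def IsSmoothForm (α : DiffForm E M k) : Prop :=
  ∀ x₀ : M, ContDiffOn ℝ ∞ (chartRep α x₀) (chartAt E x₀).target

/-- The exterior derivative, computed at `x` in the preferred chart at `x`. It is normalized so that
`dα(X₀, …, X_k) = ∑ (-1)^i X_i(α(…, omit X_i, …)) + …`, without numerical factor. -/
def extD (α : DiffForm E M k) : DiffForm E M (k + 1) := fun x =>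
  (extDeriv (chartRep α x) (chartAt E x x)).compContinuousLinearMap
    (mfderiv 𝓘(ℝ, E) 𝓘(ℝ, E) (chartAt E x) x)

end Forms

/-! ## Moment spaces for a Lie group -/

section Actions

variable {EG : Type*} [NormedAddCommGroup EG] [NormedSpace ℝ EG]
  {G : Type*} [TopologicalSpace G] [ChartedSpace EG G] [Group G]
  {EP : Type*} [NormedAddCommGroup EP] [NormedSpace ℝ EP]
  {P : Type*} [TopologicalSpace P] [ChartedSpace EP P] [MulAction G P]
  {EM : Type*} [NormedAddCommGroup EM] [NormedSpace ℝ EM]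
  {M : Type*} [TopologicalSpace M] [ChartedSpace EM M] [MulAction G M]

/-- The adjoint representation: `Ad g` is the derivative at `1` of `x ↦ g x g⁻¹`. -/
def Ad (g : G) : GroupLieAlgebra 𝓘(ℝ, EG) G →L[ℝ] GroupLieAlgebra 𝓘(ℝ, EG) G :=
  mfderiv 𝓘(ℝ, EG) 𝓘(ℝ, EG) (fun x : G => g * x * g⁻¹) (1 : G)

/-- The fundamental vector field `ξ_M(x) = d/dt (exp (tξ) • x)` at `t = 0`: the derivative at `1` of
the orbit map `g ↦ g • x`, applied to `ξ`. -/
def fundVF (EM : Type*) [NormedAddCommGroup EM] [NormedSpace ℝ EM]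
    {M : Type*} [TopologicalSpace M] [ChartedSpace EM M] [MulAction G M]
    (ξ : GroupLieAlgebra 𝓘(ℝ, EG) G) (x : M) : TangentSpace 𝓘(ℝ, EM) x :=
  mfderiv 𝓘(ℝ, EG) 𝓘(ℝ, EM) (fun g : G => g • x) (1 : G) ξ

/-- `(P, Ξ + τ)` is a premoment space for `G`: `P` is a `G`-manifold and `Ξ + τ` is a closed
`G`-equivariant three-form on `P`, with `Ξ ∈ Ω³(P)^G` and `τ ∈ (Ω¹(P) ⊗ 𝔤^*)^G`. -/
structure IsPremomentSpace (Ξ : DiffForm EP P 3)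
    (τ : GroupLieAlgebra 𝓘(ℝ, EG) G →ₗ[ℝ] DiffForm EP P 1) : Prop where
  isManifold : IsManifold 𝓘(ℝ, EP) ∞ P
  smooth_action : ContMDiffSMul 𝓘(ℝ, EG) 𝓘(ℝ, EP) ∞ G P
  smooth_Ξ : IsSmoothForm Ξ
  smooth_τ : ∀ ξ, IsSmoothForm (τ ξ)
  /-- `Ξ` is `G`-invariant -/
  invariant : ∀ g : G, pullback (fun p : P => g • p) Ξ = Ξ
  /-- `τ(Ad_g ξ) = (g⁻¹)^* τ(ξ)` -/
  equivariant : ∀ (g : G) (ξ : GroupLieAlgebra 𝓘(ℝ, EG) G),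
    τ (Ad g ξ) = pullback (fun p : P => g⁻¹ • p) (τ ξ)
  /-- `dΞ = 0` -/
  closed₁ : extD Ξ = 0
  /-- `ι_ξ Ξ = dτ(ξ)` -/
  closed₂ : ∀ (ξ : GroupLieAlgebra 𝓘(ℝ, EG) G) (p : P) (u v : TangentSpace 𝓘(ℝ, EP) p),
    Ξ p ![fundVF EP ξ p, u, v] = extD (τ ξ) p ![u, v]
  /-- `ι_ξ τ(ξ) = 0` -/
  closed₃ : ∀ (ξ : GroupLieAlgebra 𝓘(ℝ, EG) G) (p : P), τ ξ p ![fundVF EP ξ p] = 0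

/-- `(M, α, Φ)`, with `M` a `G`-manifold, `α` an invariant two-form and `Φ : M → P` an equivariant
map, is a `P`-momental `G`-space: `d_G α = -Φ^*(Ξ + τ)`, where `(d_G α)(ξ) = dα - ι_ξ α`. -/
structure IsMomental (Ξ : DiffForm EP P 3)
    (τ : GroupLieAlgebra 𝓘(ℝ, EG) G →ₗ[ℝ] DiffForm EP P 1)
    (α : DiffForm EM M 2) (Φ : M → P) : Prop where
  isManifold : IsManifold 𝓘(ℝ, EM) ∞ M
  smooth_action : ContMDiffSMul 𝓘(ℝ, EG) 𝓘(ℝ, EM) ∞ G M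
  smooth_form : IsSmoothForm α
  smooth_map : ContMDiff 𝓘(ℝ, EM) 𝓘(ℝ, EP) ∞ Φ
  invariant : ∀ g : G, pullback (fun x : M => g • x) α = α
  equivariant : ∀ (g : G) (x : M), Φ (g • x) = g • Φ x
  /-- `dα = -Φ^* Ξ` -/
  moment₁ : extD α = -pullback Φ Ξ
  /-- `ι(ξ_M) α = Φ^* τ(ξ)` -/
  moment₂ : ∀ (ξ : GroupLieAlgebra 𝓘(ℝ, EG) G) (x : M) (v : TangentSpace 𝓘(ℝ, EM) x),
    α x ![fundVF EM ξ x, v] = pullback Φ (τ ξ) x ![v]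

/-- `(M, α, Φ)` is a `P`-Hamiltonian `G`-space: it is `P`-momental, and `α` is minimally degenerate,
i.e. `ker α_x = {ξ_M(x) : ξ ∈ ker τ_{Φ(x)}}` for all `x`, with `τ_p : 𝔤 → T_p^* P`, `ξ ↦ τ(ξ)_p`. -/
structure IsHamiltonian (Ξ : DiffForm EP P 3)
    (τ : GroupLieAlgebra 𝓘(ℝ, EG) G →ₗ[ℝ] DiffForm EP P 1)
    (α : DiffForm EM M 2) (Φ : M → P) : Prop extends IsMomental Ξ τ α Φ where
  min_degenerate : ∀ x : M,
    {v : TangentSpace 𝓘(ℝ, EM) x | ∀ w : TangentSpace 𝓘(ℝ, EM) x, α x ![v, w] = 0} =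
      {v | ∃ ξ : GroupLieAlgebra 𝓘(ℝ, EG) G, τ ξ (Φ x) = 0 ∧ v = fundVF EM ξ x}

/-- `α` is the two-form `ω_O` on the orbit `O` through `p`:
`ω_O(ξ_O(q), η_O(q)) = τ(ξ)_q(η_P(q))`. -/
def IsOrbitForm (τ : GroupLieAlgebra 𝓘(ℝ, EG) G →ₗ[ℝ] DiffForm EP P 1) {p : P}
    [TopologicalSpace (MulAction.orbit G p)] [ChartedSpace EM (MulAction.orbit G p)]
    (α : DiffForm EM (MulAction.orbit G p) 2) : Prop :=
  ∀ (q : MulAction.orbit G p) (ξ η : GroupLieAlgebra 𝓘(ℝ, EG) G),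
    α q ![fundVF EM ξ q, fundVF EM η q] = τ ξ (q : P) ![fundVF EP η (q : P)]

/-- A premoment space `(P, Ξ + τ)` is a moment space for `G` if every orbit `O ⊆ P`, with the
two-form `ω_O` and the inclusion `O → P` as moment map, is a `P`-Hamiltonian `G`-space.

The manifold structure of `O = G • p` is that of the homogeneous space `G / G_p`: the (unique) one
for which the orbit map `g ↦ g • p`, `G → O`, is a smooth submersion. Its topology is the one carried
by that structure; it is the subspace topology if `G` is compact and `P` is Hausdorff. -/
structure IsMomentSpace (Ξ : DiffForm EP P 3)
    (τ : GroupLieAlgebra 𝓘(ℝ, EG) G →ₗ[ℝ] DiffForm EP P 1) : Prop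
    extends IsPremomentSpace Ξ τ where
  orbit_hamiltonian : ∀ (p : P) (n : ℕ) [TopologicalSpace (MulAction.orbit G p)]
    [ChartedSpace (EuclideanSpace ℝ (Fin n)) (MulAction.orbit G p)],
    IsManifold 𝓘(ℝ, EuclideanSpace ℝ (Fin n)) ∞ (MulAction.orbit G p) →
    Manifold.IsSubmersion 𝓘(ℝ, EG) 𝓘(ℝ, EuclideanSpace ℝ (Fin n)) ∞
      (fun g : G => (⟨g • p, MulAction.mem_orbit p g⟩ : MulAction.orbit G p)) →
    ∃! α : DiffForm (EuclideanSpace ℝ (Fin n)) (MulAction.orbit G p) 2,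
      IsOrbitForm τ α ∧ IsHamiltonian Ξ τ α (Subtype.val : MulAction.orbit G p → P)

end Actions

/-! ## Legendrian symmetric pairs and the forms on the quotient -/

section Symmetric

variable {EH : Type*} [NormedAddCommGroup EH] [NormedSpace ℝ EH]
  {H : Type*} [TopologicalSpace H] [ChartedSpace EH H] [Group H]

/-- `(H, G)` is a symmetric pair with involution `σ`. -/
structure IsSymmetricPair (EH : Type*) [NormedAddCommGroup EH] [NormedSpace ℝ EH]
    {H : Type*} [TopologicalSpace H] [ChartedSpace EH H] [Group H]
    (σ : H →* H) (G : Subgroup H) : Prop where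
  smooth : ContMDiff 𝓘(ℝ, EH) 𝓘(ℝ, EH) ∞ σ
  involutive : ∀ h : H, σ (σ h) = h
  ne_id : σ ≠ MonoidHom.id H
  isClosed : IsClosed (G : Set H)
  /-- the identity component of the fixed point group `H^σ` lies in `G` -/
  identity_component_subset : connectedComponentIn {h : H | σ h = h} 1 ⊆ (G : Set H)
  /-- `G` lies in `H^σ` -/
  subset_fixed : ∀ g ∈ G, σ g = g

/-- The differential `s = dσ` at the identity, an endomorphism of the Lie algebra `𝔥`. -/
def dInvol (σ : H →* H) : GroupLieAlgebra 𝓘(ℝ, EH) H →L[ℝ] GroupLieAlgebra 𝓘(ℝ, EH) H :=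
  mfderiv 𝓘(ℝ, EH) 𝓘(ℝ, EH) σ (1 : H)

/-- A Legendrian form on a vector space with involution `s`: a nondegenerate symmetric bilinear form
for which `s` is skew-symmetric. -/
structure IsLegendrianForm {V : Type*} [AddCommGroup V] [Module ℝ V] (s : V →ₗ[ℝ] V)
    (Λ : LinearMap.BilinForm ℝ V) : Prop where
  symm : ∀ x y, Λ x y = Λ y x
  nondegenerate : Λ.Nondegenerate
  skew : ∀ x y, Λ (s x) y = -Λ x (s y)

/-- `Λ` is a Legendrian structure on the symmetric pair with involution `σ`: a Legendrian form on
`(𝔥, s)` that is invariant under the adjoint actions of `𝔥` and of `H`. -/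
structure IsLegendrianStructure (σ : H →* H)
    (Λ : LinearMap.BilinForm ℝ (GroupLieAlgebra 𝓘(ℝ, EH) H)) : Prop
    extends IsLegendrianForm (dInvol σ).toLinearMap Λ where
  ad_invariant : ∀ x y z : GroupLieAlgebra 𝓘(ℝ, EH) H, Λ ⁅x, y⁆ z = -Λ y ⁅x, z⁆
  Ad_invariant : ∀ (h : H) (x y : GroupLieAlgebra 𝓘(ℝ, EH) H), Λ (Ad h x) y = Λ x (Ad h⁻¹ y)

/-- The left-invariant Maurer-Cartan form `θ ∈ Ω¹(H, 𝔥)`. -/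
def maurerCartan (h : H) : TangentSpace 𝓘(ℝ, EH) h →L[ℝ] GroupLieAlgebra 𝓘(ℝ, EH) H :=
  mfderiv 𝓘(ℝ, EH) 𝓘(ℝ, EH) (fun x : H => h⁻¹ * x) h

/-- The `𝔭`-part `π = ((1 - s) / 2) θ` of the Maurer-Cartan form, `𝔭` being the `-1` eigenspace
of `s`. -/
def piForm (σ : H →* H) (h : H) (v : TangentSpace 𝓘(ℝ, EH) h) : GroupLieAlgebra 𝓘(ℝ, EH) H :=
  (1 / 2 : ℝ) • (maurerCartan h v - dInvol σ (maurerCartan h v))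

/-- The one-form `β(x)_h = Λ(x, Ad_h π)` on `H`, for `x ∈ 𝔥`. -/
def betaForm (σ : H →* H) (Λ : LinearMap.BilinForm ℝ (GroupLieAlgebra 𝓘(ℝ, EH) H))
    (x : GroupLieAlgebra 𝓘(ℝ, EH) H) (h : H) (v : TangentSpace 𝓘(ℝ, EH) h) : ℝ :=
  Λ x (Ad h (piForm σ h v))

/-- The two-form `[π, π]`: by the usual wedge convention, `[π, π](u, v) = [π u, π v] - [π v, π u]`. -/
def bracketPi (σ : H →* H) (h : H) (u v : TangentSpace 𝓘(ℝ, EH) h) :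
    GroupLieAlgebra 𝓘(ℝ, EH) H :=
  ⁅piForm σ h u, piForm σ h v⁆ - ⁅piForm σ h v, piForm σ h u⁆

/-- The three-form `Υ = (1/3) Λ(π, [π, π])` on `H`, the pairing of a one-form and a two-form being
the wedge product, i.e. a cyclic sum. -/
def upsilonForm (σ : H →* H) (Λ : LinearMap.BilinForm ℝ (GroupLieAlgebra 𝓘(ℝ, EH) H))
    (h : H) (u v w : TangentSpace 𝓘(ℝ, EH) h) : ℝ :=
  (1 / 3 : ℝ) * (Λ (piForm σ h u) (bracketPi σ h v w) + Λ (piForm σ h v) (bracketPi σ h w u)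
    + Λ (piForm σ h w) (bracketPi σ h u v))

variable {EG : Type*} [NormedAddCommGroup EG] [NormedSpace ℝ EG]
  {EP : Type*} [NormedAddCommGroup EP] [NormedSpace ℝ EP]

/-- The inclusion `𝔤 → 𝔥` of Lie algebras: the differential at `1` of the inclusion `G → H`. -/
def lieIncl (G : Subgroup H) [ChartedSpace EG G] :
    GroupLieAlgebra 𝓘(ℝ, EG) G →L[ℝ] GroupLieAlgebra 𝓘(ℝ, EH) H :=
  mfderiv 𝓘(ℝ, EG) 𝓘(ℝ, EH) (Subtype.val : G → H) (1 : G)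

/-- `Ξ` and `τ` are the forms on `P = H/G` induced by `Υ` and `β`: with `j : H → H/G` the quotient
map, `j^* Ξ = Υ`, and `j^* τ(ξ) = β(ξ)` for all `ξ ∈ 𝔤`. -/
structure IsInduced {G : Subgroup H} [ChartedSpace EG G] [ChartedSpace EP (H ⧸ G)] (σ : H →* H)
    (Λ : LinearMap.BilinForm ℝ (GroupLieAlgebra 𝓘(ℝ, EH) H)) (Ξ : DiffForm EP (H ⧸ G) 3)
    (τ : GroupLieAlgebra 𝓘(ℝ, EG) G →ₗ[ℝ] DiffForm EP (H ⧸ G) 1) : Prop where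
  pullback_Ξ : ∀ (h : H) (u v w : TangentSpace 𝓘(ℝ, EH) h),
    pullback (QuotientGroup.mk : H → H ⧸ G) Ξ h ![u, v, w] = upsilonForm σ Λ h u v w
  pullback_τ : ∀ (ξ : GroupLieAlgebra 𝓘(ℝ, EG) G) (h : H) (v : TangentSpace 𝓘(ℝ, EH) h),
    pullback (QuotientGroup.mk : H → H ⧸ G) (τ ξ) h ![v] = betaForm σ Λ (lieIncl G ξ) h v

end Symmetric

end MomentSpace

end

open scoped Topology

open Filter

noncomputable section

namespace MomentSpace

/-! ### Differential calculus on model spaces: derivatives, pullback of forms, naturality of d -/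

section Tderiv
variable {E : Type*} [NormedAddCommGroup E] [NormedSpace ℝ E]
  {M : Type*} [TopologicalSpace M] [ChartedSpace E M]
  {E' : Type*} [NormedAddCommGroup E'] [NormedSpace ℝ E']
  {N : Type*} [TopologicalSpace N] [ChartedSpace E' N]
  {E'' : Type*} [NormedAddCommGroup E''] [NormedSpace ℝ E'']
  {Q : Type*} [TopologicalSpace Q] [ChartedSpace E'' Q]
  {k : ℕ}

/-! Everything on `P = H/G` is pulled back from `H` by the Cartan map `c(h) = σ(h) h⁻¹`. Since `σ`
fixes `G`, `c` is constant on cosets `hG`, so it descends to a smooth map `H/G → H` (`cartanQuot`),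
and it turns the action of `G` into conjugation. Its logarithmic derivative is `c^*θ = -2 Ad_h π`
(`mc_tderiv_cartan`). Hence `Ξ` is the pullback of the left-invariant form with value `-¼ Λ(x, [y,
z])` at `1`, and `τ(ξ)` that of `-½ Λ(ξ, θ)`: the constants cancel the powers of `-2`. Uniqueness
holds because the quotient map is a submersion.

The axioms of a premoment space then reduce to facts about left-invariant forms. `dΞ = 0` because a
biinvariant form of odd degree is closed (`extD_leftForm_eq_zero`, by inversion). `ι_ξ Ξ = dτ(ξ)` is
the Maurer-Cartan equation together with `[𝔭, 𝔭] ⊆ 𝔤`. Equivariance is the invariance of `Λ` under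
`Ad`, and `ι_ξ τ(ξ) = 0` holds because `𝔤` is isotropic for `Λ`.

On an orbit, `(ξ, η) ↦ τ(ξ)(η_P)` is skew by polarization, so it descends to a two-form. Pulled back
to `G` along an orbit map this form is left-invariant, which gives its smoothness and its exterior
derivative (`pullback_orbitForm`, `formAt_extD_orbitForm`). With `a, b, c` the images of `ξ, η, ζ`
under `Ad_{h⁻¹}`, the equation `dω = -Ξ` becomes the algebraic identity `LegendrianData.cocycle`,
valid because `Λ(a, [b, c]) = 0`.

Minimal degeneracy is where `Λ` being Legendrian is decisive: both eigenspaces of `s` are isotropic,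
and `𝔤`, the `+1` eigenspace (`exists_inc_eq`), contains its own orthogonal
(`LegendrianData.fixed_of_orthogonal`). If `ξ_P` lies in the kernel of `ω` at `hG`, then `Ad_h s a`
with `a = Ad_{h⁻¹} ξ` is orthogonal to `𝔤`, hence equals some `ξ₁ ∈ 𝔤`. The vector `ξ' = ½(ξ - ξ₁)`
satisfies `Ad_{h⁻¹} ξ' = (a - s a)/2`, which lies in `𝔭`; so `τ(ξ')` vanishes at the point, while
`ξ'` and `ξ` generate the same tangent vector there. -/

variable (E E') in
/-- The manifold derivative, as a map between the model spaces. -/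
def tderiv (f : M → N) (x : M) : E →L[ℝ] E' := mfderiv 𝓘(ℝ, E) 𝓘(ℝ, E') f x

variable (E E') in
/-- Differentiability between manifolds modelled on normed spaces. -/
abbrev TDiffAt (f : M → N) (x : M) : Prop := MDifferentiableAt 𝓘(ℝ, E) 𝓘(ℝ, E') f x

variable (E E') in
/-- Smoothness at a point between manifolds modelled on normed spaces. -/
abbrev SmoothAt (f : M → N) (x : M) : Prop := ContMDiffAt 𝓘(ℝ, E) 𝓘(ℝ, E') ∞ f x

theorem SmoothAt.tdiff {f : M → N} {x : M} (h : SmoothAt E E' f x) : TDiffAt E E' f x :=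
  h.mdifferentiableAt (by simp)

theorem SmoothAt.eventually_tdiff [IsManifold 𝓘(ℝ, E) ∞ M] [IsManifold 𝓘(ℝ, E') ∞ N]
    {f : M → N} {x : M} (h : SmoothAt E E' f x) : ∀ᶠ y in 𝓝 x, TDiffAt E E' f y := by
  have : IsManifold 𝓘(ℝ, E) 1 M := .of_le (n := ∞) (by simp)
  have : IsManifold 𝓘(ℝ, E') 1 N := .of_le (n := ∞) (by simp)
  have h1 : ContMDiffAt 𝓘(ℝ, E) 𝓘(ℝ, E') 1 f x := h.of_le (by simp)
  filter_upwards [(contMDiffAt_iff_contMDiffAt_nhds (by simp)).1 h1] with y hy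
    using hy.mdifferentiableAt (by simp)

theorem tderiv_comp {g : N → Q} {f : M → N} {x : M} (hg : TDiffAt E' E'' g (f x))
    (hf : TDiffAt E E' f x) :
    tderiv E E'' (g ∘ f) x = (tderiv E' E'' g (f x)).comp (tderiv E E' f x) :=
  mfderiv_comp x hg hf

theorem tderiv_comp_apply {g : N → Q} {f : M → N} {x : M} (hg : TDiffAt E' E'' g (f x))
    (hf : TDiffAt E E' f x) (v : E) :
    tderiv E E'' (fun y => g (f y)) x v = tderiv E' E'' g (f x) (tderiv E E' f x v) :=
  DFunLike.congr_fun (tderiv_comp hg hf) v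

theorem tderiv_congr {f g : M → N} {x : M} (h : f =ᶠ[𝓝 x] g) :
    tderiv E E' f x = tderiv E E' g x :=
  h.mfderiv_eq

@[simp] theorem tderiv_id (x : M) : tderiv E E (fun y : M => y) x = ContinuousLinearMap.id ℝ E :=
  mfderiv_id

@[simp] theorem tderiv_const (y : N) (x : M) : tderiv E E' (fun _ : M => y) x = 0 :=
  mfderiv_const

theorem tderiv_eq_fderiv (f : E → E') (x : E) : tderiv E E' f x = fderiv ℝ f x :=
  mfderiv_eq_fderiv

theorem smoothAt_chart [IsManifold 𝓘(ℝ, E) ∞ M] {x₀ x : M} (hx : x ∈ (chartAt E x₀).source) :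
    SmoothAt E E (chartAt E x₀) x :=
  contMDiffAt_of_mem_maximalAtlas (IsManifold.chart_mem_maximalAtlas x₀) hx

theorem smoothAt_chart_symm [IsManifold 𝓘(ℝ, E) ∞ M] {x₀ : M} {y : E}
    (hy : y ∈ (chartAt E x₀).target) : SmoothAt E E (chartAt E x₀).symm y :=
  contMDiffAt_symm_of_mem_maximalAtlas (IsManifold.chart_mem_maximalAtlas x₀) hy

theorem tderiv_chart_symm_comp [IsManifold 𝓘(ℝ, E) ∞ M] {x₀ x : M}
    (hx : x ∈ (chartAt E x₀).source) :
    (tderiv E E (chartAt E x₀).symm (chartAt E x₀ x)).comp (tderiv E E (chartAt E x₀) x)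
      = ContinuousLinearMap.id ℝ E := by
  rw [← tderiv_comp (smoothAt_chart_symm ((chartAt E x₀).map_source hx)).tdiff
    (smoothAt_chart hx).tdiff, ← tderiv_id x]
  refine tderiv_congr ?_
  filter_upwards [(chartAt E x₀).open_source.mem_nhds hx] with y hy
    using (chartAt E x₀).left_inv hy

theorem tderiv_chart_comp_symm [IsManifold 𝓘(ℝ, E) ∞ M] {x₀ : M} {y : E}
    (hy : y ∈ (chartAt E x₀).target) :
    (tderiv E E (chartAt E x₀) ((chartAt E x₀).symm y)).comp (tderiv E E (chartAt E x₀).symm y)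
      = ContinuousLinearMap.id ℝ E := by
  rw [← tderiv_comp (smoothAt_chart ((chartAt E x₀).map_target hy)).tdiff
    (smoothAt_chart_symm hy).tdiff, ← tderiv_id y]
  refine tderiv_congr ?_
  filter_upwards [(chartAt E x₀).open_target.mem_nhds hy] with z hz
    using (chartAt E x₀).right_inv hz

/-! ### Pullback of forms -/

/-- The value of a form at a point, as an alternating form on the model space. -/
def formAt (α : DiffForm E M k) (x : M) : E [⋀^Fin k]→L[ℝ] ℝ := α x

theorem formAt_ext {α β : DiffForm E M k} (h : ∀ x, formAt α x = formAt β x) : α = β :=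
  funext h

theorem formAt_pullback (f : M → N) (α : DiffForm E' N k) (x : M) :
    formAt (E := E) (pullback f α) x = (formAt α (f x)).compContinuousLinearMap
      (tderiv E E' f x) := rfl

theorem chartRep_eq (α : DiffForm E M k) (x₀ : M) (y : E) :
    chartRep α x₀ y = (formAt α ((chartAt E x₀).symm y)).compContinuousLinearMap
      (tderiv E E (chartAt E x₀).symm y) := rfl

theorem formAt_pullback_apply (f : M → N) (α : DiffForm E' N k) (x : M) (v : Fin k → E) :
    formAt (pullback f α) x v = formAt α (f x) (fun i => tderiv E E' f x (v i)) := rfl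

theorem formAt_extD (α : DiffForm E M k) (x : M) :
    formAt (extD α) x = (extDeriv (chartRep α x) (chartAt E x x)).compContinuousLinearMap
      (tderiv E E (chartAt E x) x) := rfl

theorem formAt_pullback_comp {g : N → Q} {f : M → N} {x : M} (hg : TDiffAt E' E'' g (f x))
    (hf : TDiffAt E E' f x) (α : DiffForm E'' Q k) :
    formAt (E := E) (pullback (fun y => g (f y)) α) x =
      formAt (pullback f (pullback (E := E') g α)) x := by
  have := tderiv_comp hg hf
  change tderiv E E'' (fun y => g (f y)) x = _ at this
  rw [formAt_pullback, this]
  rfl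

theorem formAt_pullback_congr {f g : M → N} {x : M} (h : f =ᶠ[𝓝 x] g) (α : DiffForm E' N k) :
    formAt (E := E) (pullback f α) x = formAt (pullback g α) x := by
  rw [formAt_pullback, formAt_pullback, tderiv_congr h, h.eq_of_nhds]

theorem formAt_pullback_id (α : DiffForm E M k) (x : M) :
    formAt (pullback (fun y : M => y) α) x = formAt α x := by
  rw [formAt_pullback, tderiv_id]; rfl

section
variable [IsManifold 𝓘(ℝ, E) ∞ M] [IsManifold 𝓘(ℝ, E') ∞ N]

/-- Inserting the chart of `N` and its inverse between `α` and `f` turns a pullback on manifolds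
into a pullback by the coordinate expression of `f`. The charts `x₀`, `z₀` are arbitrary charts
around `x` and `f x`, as the definition of `SmoothFormAt` demands. -/
theorem chartRep_pullback (α : DiffForm E' N k) {f : M → N} {x x₀ : M} {z₀ : N}
    (hf : SmoothAt E E' f x) (hx : x ∈ (chartAt E x₀).source)
    (hz : f x ∈ (chartAt E' z₀).source) :
    chartRep (E := E) (pullback f α) x₀ =ᶠ[𝓝 (chartAt E x₀ x)] fun y =>
      (chartRep α z₀ ((chartAt E' z₀ ∘ f ∘ (chartAt E x₀).symm) y)).compContinuousLinearMap
        (fderiv ℝ (chartAt E' z₀ ∘ f ∘ (chartAt E x₀).symm) y) := by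
  have htend : Tendsto (chartAt E x₀).symm (𝓝 (chartAt E x₀ x)) (𝓝 x) :=
    (chartAt E x₀).tendsto_symm hx
  have h1 := htend.eventually hf.eventually_tdiff
  have h2 := htend.eventually (hf.continuousAt.eventually ((chartAt E' z₀).open_source.mem_nhds hz))
  filter_upwards [h1, h2, (chartAt E x₀).open_target.mem_nhds ((chartAt E x₀).map_source hx)]
    with y hy1 hy2 hy3
  have hs := (smoothAt_chart_symm hy3).tdiff
  have hc := (smoothAt_chart hy2).tdiff
  rw [← tderiv_eq_fderiv, tderiv_comp (f := f ∘ (chartAt E x₀).symm) hc (hy1.comp y hs),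
    tderiv_comp (g := f) hy1 hs, chartRep_eq, chartRep_eq]
  have hid := tderiv_chart_symm_comp hy2
  have e : ∀ w : E', tderiv E' E' (chartAt E' z₀).symm
      (chartAt E' z₀ (f ((chartAt E x₀).symm y)))
      (tderiv E' E' (chartAt E' z₀) (f ((chartAt E x₀).symm y)) w) = w :=
    fun w => DFunLike.congr_fun hid w
  ext v
  simp only [ContinuousAlternatingMap.compContinuousLinearMap_apply, Function.comp_def,
    ContinuousLinearMap.comp_apply, formAt_pullback_apply, e, (chartAt E' z₀).left_inv hy2]

theorem SmoothAt.contDiffAt_charts {f : M → N} {x x₀ : M} {z₀ : N}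
    (hf : SmoothAt E E' f x) (hx : x ∈ (chartAt E x₀).source)
    (hz : f x ∈ (chartAt E' z₀).source) :
    ContDiffAt ℝ ∞ (chartAt E' z₀ ∘ f ∘ (chartAt E x₀).symm) (chartAt E x₀ x) := by
  have hl := (chartAt E x₀).left_inv hx
  have h1 : SmoothAt E E (chartAt E x₀).symm (chartAt E x₀ x) :=
    smoothAt_chart_symm ((chartAt E x₀).map_source hx)
  have h2 : SmoothAt E E' (f ∘ (chartAt E x₀).symm) (chartAt E x₀ x) :=
    ContMDiffAt.comp _ (by rw [hl]; exact hf) h1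
  have h3 : SmoothAt E E' (chartAt E' z₀ ∘ f ∘ (chartAt E x₀).symm) (chartAt E x₀ x) :=
    ContMDiffAt.comp _ (smoothAt_chart (by simpa [hl] using hz)) h2
  exact h3.contDiffAt
end

/-! ### Smooth forms -/

/-- Smoothness of a form near a point. -/
def SmoothFormAt (α : DiffForm E M k) (x : M) : Prop :=
  ∀ x₀, x ∈ (chartAt E x₀).source → ContDiffAt ℝ ∞ (chartRep α x₀) (chartAt E x₀ x)

theorem isSmoothForm_iff {α : DiffForm E M k} : IsSmoothForm α ↔ ∀ x, SmoothFormAt α x := by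
  refine ⟨fun h x x₀ hx => (h x₀).contDiffAt ((chartAt E x₀).open_target.mem_nhds
    ((chartAt E x₀).map_source hx)), fun h x₀ y hy => ?_⟩
  have := h _ x₀ ((chartAt E x₀).map_target hy)
  rw [(chartAt E x₀).right_inv hy] at this
  exact this.contDiffWithinAt

theorem chartRep_congr {α β : DiffForm E M k} {x x₀ : M}
    (h : ∀ᶠ y in 𝓝 x, formAt α y = formAt β y) (hx : x ∈ (chartAt E x₀).source) :
    chartRep α x₀ =ᶠ[𝓝 (chartAt E x₀ x)] chartRep β x₀ := by
  filter_upwards [((chartAt E x₀).tendsto_symm hx).eventually h] with y hy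
  rw [chartRep_eq, hy, chartRep_eq]

theorem SmoothFormAt.congr {α β : DiffForm E M k} {x : M} (hα : SmoothFormAt α x)
    (h : ∀ᶠ y in 𝓝 x, formAt α y = formAt β y) : SmoothFormAt β x := fun x₀ hx =>
  (hα x₀ hx).congr_of_eventuallyEq (chartRep_congr h hx).symm

theorem formAt_extD_neg (α : DiffForm E M k) (x : M) :
    formAt (extD (-α)) x = -formAt (extD α) x := by
  have : chartRep (-α) x = (-1 : ℝ) • chartRep α x := by
    funext y
    ext v
    have e : ∀ z, formAt (-α) z = -formAt α z := fun _ => rfl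
    simp [chartRep_eq, e]
  rw [formAt_extD, this, extDeriv_smul, formAt_extD]
  ext v
  simp

/-- For multilinear maps, precomposition is itself multilinear in the linear maps, hence smooth.
Alternating maps embed linearly in multilinear maps, and in finite dimension this embedding has a
continuous linear left inverse, which carries the smoothness back. -/
theorem contDiff_compContinuousLinearMap [FiniteDimensional ℝ E] [FiniteDimensional ℝ E'] :
    ContDiff ℝ ∞ (fun p : (E' [⋀^Fin k]→L[ℝ] ℝ) × (E →L[ℝ] E') =>
      p.1.compContinuousLinearMap p.2) := by
  let T : E [⋀^Fin k]→L[ℝ] ℝ →L[ℝ] ContinuousMultilinearMap ℝ (fun _ : Fin k => E) ℝ :=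
    ContinuousAlternatingMap.toContinuousMultilinearMapCLM ℝ
  have : FiniteDimensional ℝ (ContinuousMultilinearMap ℝ (fun _ : Fin k => E) ℝ) :=
    FiniteDimensional.of_injective
      (ContinuousMultilinearMap.toMultilinearMapLinear :
        ContinuousMultilinearMap ℝ (fun _ : Fin k => E) ℝ →ₗ[ℝ] _)
      ContinuousMultilinearMap.toMultilinearMap_injective
  have hT : LinearMap.ker T.toLinearMap = ⊥ := LinearMap.ker_eq_bot.2
    ContinuousAlternatingMap.toContinuousMultilinearMap_injective
  let T' : E' [⋀^Fin k]→L[ℝ] ℝ →L[ℝ] ContinuousMultilinearMap ℝ (fun _ : Fin k => E') ℝ :=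
    ContinuousAlternatingMap.toContinuousMultilinearMapCLM ℝ
  obtain ⟨L, hL⟩ := T.toLinearMap.exists_leftInverse_of_injective hT
  have key : (fun p : (E' [⋀^Fin k]→L[ℝ] ℝ) × (E →L[ℝ] E') => p.1.compContinuousLinearMap p.2) =
      fun p => LinearMap.toContinuousLinearMap L
        (ContinuousMultilinearMap.compContinuousLinearMapContinuousMultilinear ℝ
          (fun _ : Fin k => E) (fun _ : Fin k => E') ℝ (fun _ => p.2)
          (T' p.1)) := by
    funext p
    exact (DFunLike.congr_fun hL (p.1.compContinuousLinearMap p.2)).symm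
  rw [key]
  refine (LinearMap.toContinuousLinearMap L).contDiff.comp ?_
  refine ContDiff.clm_apply ?_ ?_
  · exact (ContinuousMultilinearMap.contDiff _).comp (contDiff_pi.2 fun _ => contDiff_snd)
  · exact T'.contDiff.comp contDiff_fst

section
variable [IsManifold 𝓘(ℝ, E) ∞ M] [IsManifold 𝓘(ℝ, E') ∞ N]

theorem SmoothFormAt.pullback [FiniteDimensional ℝ E] [FiniteDimensional ℝ E']
    {α : DiffForm E' N k} {f : M → N} {x : M}
    (hα : SmoothFormAt α (f x)) (hf : SmoothAt E E' f x) :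
    SmoothFormAt (E := E) (pullback f α) x := by
  intro x₀ hx
  have hz := mem_chart_source E' (f x)
  refine ContDiffAt.congr_of_eventuallyEq ?_ (chartRep_pullback α hf hx hz)
  have hF := hf.contDiffAt_charts hx hz
  refine contDiff_compContinuousLinearMap.contDiffAt.comp _ (ContDiffAt.prodMk ?_ ?_)
  · refine ContDiffAt.comp (g := chartRep α (f x)) _ ?_ hF
    simpa [(chartAt E x₀).left_inv hx] using hα (f x) hz
  · exact hF.fderiv_right (by simp)

/-- Naturality of `d`, reduced by the coordinate expression of `f` to naturality on normed spaces.
All later computations of exterior derivatives on `P` and on its orbits pass through it to a Lie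
group. -/
theorem formAt_extD_pullback {α : DiffForm E' N k} {f : M → N} {x : M}
    (hα : SmoothFormAt α (f x)) (hf : SmoothAt E E' f x) :
    formAt (E := E) (extD (pullback f α)) x = formAt (pullback f (extD α)) x := by
  have hx := mem_chart_source E x
  have hz := mem_chart_source E' (f x)
  have hF := hf.contDiffAt_charts hx hz
  have hxx := (chartAt E x).left_inv hx
  have hr : ContDiffAt ℝ ∞ (chartRep α (f x))
      ((chartAt E' (f x) ∘ f ∘ (chartAt E x).symm) (chartAt E x x)) := by
    simpa [hxx] using hα (f x) hz
  rw [formAt_extD, (chartRep_pullback α hf hx hz).extDeriv_eq,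
    extDeriv_pullback (r := ∞) (hr.differentiableAt (by simp)) hF
      (by simpa using ENat.LEInfty.out), formAt_pullback, formAt_extD]
  · have h3 : (fderiv ℝ (chartAt E' (f x) ∘ f ∘ (chartAt E x).symm) (chartAt E x x)).comp
        (tderiv E E (chartAt E x) x) =
        (tderiv E' E' (chartAt E' (f x)) (f x)).comp (tderiv E E' f x) := by
      rw [← tderiv_eq_fderiv,
        ← tderiv_comp (hF.contMDiffAt.mdifferentiableAt (by simp)) (smoothAt_chart hx).tdiff,
        ← tderiv_comp (smoothAt_chart hz).tdiff hf.tdiff]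
      refine tderiv_congr ?_
      filter_upwards [(chartAt E x).open_source.mem_nhds hx] with y hy
      simp [(chartAt E x).left_inv hy]
    have h4 := fun w : E => DFunLike.congr_fun h3 w
    simp only [ContinuousLinearMap.comp_apply] at h4
    ext v
    simp only [ContinuousAlternatingMap.compContinuousLinearMap_apply, Function.comp_def, hxx]
    congr 1
    funext i
    exact h4 (v i)
end

end Tderiv

/-! ### Local sections of submersions and descent along them -/

section Sections
variable {E : Type*} [NormedAddCommGroup E] [NormedSpace ℝ E]
  {M : Type*} [TopologicalSpace M] [ChartedSpace E M]
  {E' : Type*} [NormedAddCommGroup E'] [NormedSpace ℝ E']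
  {N : Type*} [TopologicalSpace N] [ChartedSpace E' N]
  {E'' : Type*} [NormedAddCommGroup E''] [NormedSpace ℝ E'']
  {Q : Type*} [TopologicalSpace Q] [ChartedSpace E'' Q]
  {k : ℕ}

/-- A submersion has smooth local sections. -/
theorem exists_smooth_section [IsManifold 𝓘(ℝ, E) ∞ M] [IsManifold 𝓘(ℝ, E') ∞ N] {f : M → N}
    (hf : Manifold.IsSubmersion 𝓘(ℝ, E) 𝓘(ℝ, E') ∞ f) (x : M) :
    ∃ s : N → M, s (f x) = x ∧ SmoothAt E' E s (f x) ∧ ∀ᶠ y in 𝓝 (f x), f (s y) = y := by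
  obtain ⟨F, _, _, h⟩ := hf
  have h := h x
  have hx := h.mem_domChart_source
  have hfx := h.mem_codChart_source
  set φ := h.domChart
  set ψ := h.codChart
  set e := h.equiv
  have hw : ∀ z ∈ φ.target, ψ (f (φ.symm z)) = (e z).1 := by
    have hwr := h.writtenInCharts
    intro z hz
    have h0 := @hwr z (by simpa [φ] using hz)
    simpa using h0
  -- In adapted charts the submersion is the first projection; the section keeps the second
  -- coordinate frozen at its value at `x`.
  set s₀ : E' → E := fun a => e.symm (a, (e (φ x)).2)
  have hs₀ : ContDiff ℝ ∞ s₀ := e.symm.contDiff.comp (contDiff_id.prodMk contDiff_const)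
  have hs₀x : s₀ (ψ (f x)) = φ x := by
    have := hw (φ x) (φ.map_source hx)
    rw [φ.left_inv hx] at this
    simp [s₀, this]
  refine ⟨fun y => φ.symm (s₀ (ψ y)), by simp [hs₀x, φ.left_inv hx], ?_, ?_⟩
  · have h1 : SmoothAt E' E' ψ (f x) :=
      contMDiffAt_of_mem_maximalAtlas h.codChart_mem_maximalAtlas hfx
    have h2 : SmoothAt E' E (fun y => s₀ (ψ y)) (f x) :=
      ContMDiffAt.comp (g := s₀) (f x) hs₀.contDiffAt.contMDiffAt h1
    refine ContMDiffAt.comp (g := φ.symm) (f x) ?_ h2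
    rw [hs₀x]
    exact contMDiffAt_symm_of_mem_maximalAtlas h.domChart_mem_maximalAtlas (φ.map_source hx)
  · have hc : ContinuousAt (fun y => s₀ (ψ y)) (f x) :=
      ContinuousAt.comp (g := s₀) hs₀.continuous.continuousAt (ψ.continuousAt hfx)
    have h1 : ∀ᶠ y in 𝓝 (f x), s₀ (ψ y) ∈ φ.target :=
      hc.eventually (φ.open_target.mem_nhds (by simpa [hs₀x] using φ.map_source hx))
    filter_upwards [h1, ψ.open_source.mem_nhds hfx] with y hy1 hy2
    refine ψ.injOn (h.source_subset_preimage_source (φ.map_target hy1)) hy2 ?_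
    simp [hw _ hy1, s₀]

/-- An immersion has smooth local retractions. -/
theorem exists_smooth_retraction [IsManifold 𝓘(ℝ, E) ∞ M] [IsManifold 𝓘(ℝ, E') ∞ N] {f : M → N}
    (hf : Manifold.IsImmersion 𝓘(ℝ, E) 𝓘(ℝ, E') ∞ f) (x : M) :
    ∃ r : N → M, SmoothAt E' E r (f x) ∧ ∀ᶠ y in 𝓝 x, r (f y) = y := by
  obtain ⟨F, _, _, h⟩ := hf
  have h := h x
  have hx := h.mem_domChart_source
  have hfx := h.mem_codChart_source
  set φ := h.domChart
  set ψ := h.codChart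
  set e := h.equiv
  have hw : ∀ z ∈ φ.target, ψ (f (φ.symm z)) = e (z, 0) := by
    have hwr := h.writtenInCharts
    intro z hz
    have h0 := @hwr z (by simpa [φ] using hz)
    simpa using h0
  have hw' : ∀ y ∈ φ.source, (e.symm (ψ (f y))).1 = φ y := fun y hy => by
    have := hw (φ y) (φ.map_source hy)
    rw [φ.left_inv hy] at this
    simp [this]
  -- In adapted charts the immersion is `z ↦ (z, 0)`, so dropping the second coordinate undoes it.
  refine ⟨fun z => φ.symm (e.symm (ψ z)).1, ?_, ?_⟩
  · have h1 : SmoothAt E' E' ψ (f x) :=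
      contMDiffAt_of_mem_maximalAtlas h.codChart_mem_maximalAtlas hfx
    have h2 : SmoothAt E' E (fun y => (e.symm (ψ y)).1) (f x) :=
      ContMDiffAt.comp (g := fun a => (e.symm a).1) (f x)
        (contDiff_fst.comp e.symm.contDiff).contDiffAt.contMDiffAt h1
    refine ContMDiffAt.comp (g := φ.symm) (f x) ?_ h2
    rw [hw' x hx]
    exact contMDiffAt_symm_of_mem_maximalAtlas h.domChart_mem_maximalAtlas (φ.map_source hx)
  · filter_upwards [φ.open_source.mem_nhds hx] with y hy
    simp [hw' y hy, φ.left_inv hy]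

variable [IsManifold 𝓘(ℝ, E) ∞ M] [IsManifold 𝓘(ℝ, E') ∞ N] {f : M → N}

omit [IsManifold 𝓘(ℝ, E) ∞ M] [IsManifold 𝓘(ℝ, E') ∞ N] in
theorem smoothAt_of_isSubmersion (hf : Manifold.IsSubmersion 𝓘(ℝ, E) 𝓘(ℝ, E') ∞ f) (x : M) :
    SmoothAt E E' f x := by
  obtain ⟨F, _, _, h⟩ := hf
  exact (h x).contMDiffAt

/-- A map out of the base of a submersion is smooth when its composition with the submersion is. -/
theorem smoothAt_of_comp_isSubmersion (hf : Manifold.IsSubmersion 𝓘(ℝ, E) 𝓘(ℝ, E') ∞ f) {x : M}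
    {g : N → Q} (hg : SmoothAt E E'' (fun y => g (f y)) x) : SmoothAt E' E'' g (f x) := by
  obtain ⟨s, hsx, hs, hfs⟩ := exists_smooth_section hf x
  have h : SmoothAt E' E'' (fun y => g (f (s y))) (f x) :=
    ContMDiffAt.comp (g := fun y => g (f y)) (f x) (by rw [hsx]; exact hg) hs
  refine h.congr_of_eventuallyEq ?_
  filter_upwards [hfs] with y hy
  rw [hy]

theorem tderiv_surjective (hf : Manifold.IsSubmersion 𝓘(ℝ, E) 𝓘(ℝ, E') ∞ f) (x : M) :
    Function.Surjective (tderiv E E' f x) := by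
  intro v
  obtain ⟨s, hsx, hs, hfs⟩ := exists_smooth_section hf x
  have h1 := tderiv_comp_apply (g := f) (f := s) (x := f x)
    (by rw [hsx]; exact (smoothAt_of_isSubmersion hf x).tdiff) hs.tdiff v
  refine ⟨tderiv E' E s (f x) v, ?_⟩
  have h2 : tderiv E' E' (fun y => f (s y)) (f x) = tderiv E' E' (fun y => y) (f x) :=
    tderiv_congr hfs
  rw [h2, tderiv_id, hsx] at h1
  exact h1.symm

theorem formAt_eq_of_pullback_eq (hf : Manifold.IsSubmersion 𝓘(ℝ, E) 𝓘(ℝ, E') ∞ f) {x : M}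
    {α β : DiffForm E' N k}
    (h : formAt (E := E) (pullback f α) x = formAt (pullback f β) x) :
    formAt α (f x) = formAt β (f x) := by
  ext v
  choose w hw using fun i => tderiv_surjective hf x (v i)
  have := DFunLike.congr_fun h w
  simpa only [formAt_pullback_apply, hw] using this

/-- Near the point, `α = s^* f^* α` for a smooth local section `s` of `f`. -/
theorem smoothFormAt_of_pullback [FiniteDimensional ℝ E] [FiniteDimensional ℝ E']
    (hf : Manifold.IsSubmersion 𝓘(ℝ, E) 𝓘(ℝ, E') ∞ f) {x : M}
    {α : DiffForm E' N k} (h : SmoothFormAt (E := E) (pullback f α) x) :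
    SmoothFormAt α (f x) := by
  obtain ⟨s, hsx, hs, hfs⟩ := exists_smooth_section hf x
  have h1 : SmoothFormAt (pullback s (pullback (E := E) f α)) (f x) :=
    SmoothFormAt.pullback (by rw [hsx]; exact h) hs
  refine h1.congr ?_
  filter_upwards [hs.eventually_tdiff, hfs.eventually_nhds] with y hy hy2
  rw [← formAt_pullback_comp (smoothAt_of_isSubmersion hf _).tdiff hy]
  have := formAt_pullback_congr (E := E') (f := fun y => f (s y)) (g := fun y => y) hy2 α
  rw [this, formAt_pullback_id]

end Sections

/-! ### Left-invariant forms on a Lie group -/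

section LeftInvariant
variable {E : Type*} [NormedAddCommGroup E] [NormedSpace ℝ E]
  {H : Type*} [TopologicalSpace H] [ChartedSpace E H] [Group H]
  {E' : Type*} [NormedAddCommGroup E'] [NormedSpace ℝ E']
  {K : Type*} [TopologicalSpace K] [ChartedSpace E' K] [Group K]
  {k : ℕ}

variable (E) in
/-- The differential at `1` of the left translation by `h`. -/
def lmul (h : H) : E →L[ℝ] E := tderiv E E (fun x : H => h * x) 1

variable (E) in
/-- The Maurer-Cartan form, as an endomorphism of the model space. -/
def mc (h : H) : E →L[ℝ] E := tderiv E E (fun x : H => h⁻¹ * x) h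

variable (H) in
/-- The Lie bracket of the Lie algebra of `H`, on the model space. -/
def lieB (x y : E) : E :=
  Bracket.bracket (L := GroupLieAlgebra 𝓘(ℝ, E) H) (M := GroupLieAlgebra 𝓘(ℝ, E) H) x y

variable (H) in
/-- The left-invariant form with value `A` at `1`. -/
def leftForm (A : E [⋀^Fin k]→L[ℝ] ℝ) : DiffForm E H k := fun h =>
  (A.compContinuousLinearMap (mc E h) : E [⋀^Fin k]→L[ℝ] ℝ)

theorem formAt_leftForm (A : E [⋀^Fin k]→L[ℝ] ℝ) (h : H) :
    formAt (leftForm H A) h = A.compContinuousLinearMap (mc E h) := rfl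

variable [LieGroup 𝓘(ℝ, E) ∞ H] [LieGroup 𝓘(ℝ, E') ∞ K]

omit [LieGroup 𝓘(ℝ, E) ∞ H] in
theorem lieGroup_minSmoothness [LieGroup 𝓘(ℝ, E) ∞ H] :
    LieGroup 𝓘(ℝ, E) (minSmoothness ℝ 3) H :=
  LieGroup.of_le (n := ∞) (by simpa using ENat.LEInfty.out)

theorem smoothAt_mul_left (a x : H) : SmoothAt E E (fun y : H => a * y) x :=
  contMDiff_mul_left.contMDiffAt

theorem smoothAt_mul_right (a x : H) : SmoothAt E E (fun y : H => y * a) x :=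
  contMDiff_mul_right.contMDiffAt

theorem tderiv_mul_left (a h : H) (x : E) :
    tderiv E E (fun y : H => a * y) h (lmul E h x) = lmul E (a * h) x := by
  have := tderiv_comp_apply (g := fun y : H => a * y) (f := fun y : H => h * y) (x := 1)
    (smoothAt_mul_left a _).tdiff (smoothAt_mul_left h _).tdiff x
  simp only [← mul_assoc, mul_one] at this
  exact this.symm

omit [LieGroup 𝓘(ℝ, E) ∞ H] in
@[simp] theorem lmul_one (x : E) : lmul E (1 : H) x = x := by
  simp [lmul]

@[simp] theorem mc_lmul (h : H) (x : E) : mc E h (lmul E h x) = x := by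
  rw [mc, tderiv_mul_left, inv_mul_cancel, lmul_one]

@[simp] theorem lmul_mc (h : H) (x : E) : lmul E h (mc E h x) = x := by
  have := tderiv_comp_apply (g := fun y : H => h * y) (f := fun y : H => h⁻¹ * y) (x := h)
    (smoothAt_mul_left _ _).tdiff (smoothAt_mul_left _ _).tdiff x
  simp only [mul_inv_cancel_left, tderiv_id, inv_mul_cancel] at this
  exact this.symm

theorem mc_tderiv_mul_left (a h : H) (v : E) :
    mc E (a * h) (tderiv E E (fun y : H => a * y) h v) = mc E h v := by
  obtain ⟨x, rfl⟩ : ∃ x, lmul E h x = v := ⟨_, lmul_mc h v⟩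
  rw [tderiv_mul_left, mc_lmul, mc_lmul]

theorem formAt_leftForm_lmul (A : E [⋀^Fin k]→L[ℝ] ℝ) (h : H) (x : Fin k → E) :
    formAt (leftForm H A) h (fun i => lmul E h (x i)) = A x := by
  simp [formAt_leftForm, Function.comp_def]

/-- Left-invariant forms are invariant. -/
theorem pullback_mul_left_leftForm (a : H) (A : E [⋀^Fin k]→L[ℝ] ℝ) :
    pullback (fun y : H => a * y) (leftForm H A) = leftForm H A := by
  refine formAt_ext fun h => ?_
  ext v
  simp [formAt_pullback_apply, formAt_leftForm, Function.comp_def, mc_tderiv_mul_left]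

/-- A form invariant under left translations is determined by its value at `1`. -/
theorem eq_leftForm {α : DiffForm E H k}
    (hα : ∀ a, formAt (pullback (fun y : H => a * y) α) 1 = formAt α 1) :
    α = leftForm H (formAt α 1) := by
  refine formAt_ext fun h => ?_
  ext v
  have h1 := DFunLike.congr_fun (hα h) (fun i => mc E h (v i))
  rw [formAt_pullback_apply, mul_one] at h1
  change formAt α h (fun i => lmul E h (mc E h (v i))) = _ at h1
  simp only [lmul_mc] at h1
  rw [h1, formAt_leftForm]
  rfl

/-- The Maurer-Cartan form intertwines the differential of a homomorphism. -/
theorem mc_tderiv_hom (f : H →* K) (hf : ∀ x, TDiffAt E E' f x) (h : H) (v : E) :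
    mc E' (f h) (tderiv E E' f h v) = tderiv E E' f 1 (mc E h v) := by
  have h1 := tderiv_comp_apply (g := fun y : K => (f h)⁻¹ * y) (f := f) (x := h)
    (smoothAt_mul_left _ _).tdiff (hf h) v
  have h2 := tderiv_comp_apply (g := f) (f := fun y : H => h⁻¹ * y) (x := h)
    (hf _) (smoothAt_mul_left _ _).tdiff v
  simp only [map_mul, map_inv] at h2
  rw [h1, inv_mul_cancel] at h2
  exact h2

theorem pullback_hom_leftForm (f : H →* K) (hf : ∀ x, TDiffAt E E' f x)
    (A : E' [⋀^Fin k]→L[ℝ] ℝ) :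
    pullback f (leftForm K A) = leftForm H (A.compContinuousLinearMap (tderiv E E' f 1)) := by
  refine formAt_ext fun h => ?_
  ext v
  simp [formAt_pullback_apply, formAt_leftForm, Function.comp_def, mc_tderiv_hom f hf]

/-! ### Smoothness and exterior derivative of left-invariant forms -/

/-- The map `(a, b) ↦ a⁻¹ b` in coordinates near the diagonal. Its partial derivative in `b` along
the diagonal is the coordinate form of the Maurer-Cartan form, so its joint smoothness gives
smoothness of left-invariant forms. -/
theorem contDiffAt_translated_chart {x₀ : H} {y₀ : E} (hy : y₀ ∈ (chartAt E x₀).target) :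
    ContDiffAt ℝ ∞ (Function.uncurry fun a b : E => chartAt E (1 : H)
      (((chartAt E x₀).symm a)⁻¹ * (chartAt E x₀).symm b)) (y₀, y₀) := by
  rw [← contMDiffAt_iff_contDiffAt]
  have hs := smoothAt_chart_symm hy
  have h1 : SmoothAt (E × E) E (fun p : E × E => (chartAt E x₀).symm p.1) (y₀, y₀) :=
    ContMDiffAt.comp (g := (chartAt E x₀).symm) (y₀, y₀) hs contDiffAt_fst.contMDiffAt
  have h2 : SmoothAt (E × E) E (fun p : E × E => (chartAt E x₀).symm p.2) (y₀, y₀) :=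
    ContMDiffAt.comp (g := (chartAt E x₀).symm) (y₀, y₀) hs contDiffAt_snd.contMDiffAt
  refine ContMDiffAt.comp (g := chartAt E (1 : H)) (y₀, y₀) ?_ (h1.inv.mul h2)
  refine smoothAt_chart ?_
  simp

theorem fderiv_translated_chart {x₀ : H} {y : E} (hy : y ∈ (chartAt E x₀).target) :
    fderiv ℝ (fun b : E => chartAt E (1 : H)
      (((chartAt E x₀).symm y)⁻¹ * (chartAt E x₀).symm b)) y =
    (tderiv E E (chartAt E (1 : H)) (1 : H)).comp
      ((mc E ((chartAt E x₀).symm y)).comp (tderiv E E (chartAt E x₀).symm y)) := by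
  have hs := (smoothAt_chart_symm hy).tdiff
  set h := (chartAt E x₀).symm y
  rw [← tderiv_eq_fderiv]
  have h1 := tderiv_comp (g := fun z : H => h⁻¹ * z) (f := (chartAt E x₀).symm) (x := y)
    (smoothAt_mul_left _ _).tdiff hs
  have h2 := tderiv_comp (g := chartAt E (1 : H))
    (f := (fun z : H => h⁻¹ * z) ∘ (chartAt E x₀).symm) (x := y)
    (smoothAt_chart (by simp [h])).tdiff
    (MDifferentiableAt.comp y (smoothAt_mul_left _ _).tdiff hs)
  rw [h1] at h2
  have e : ((fun z : H => h⁻¹ * z) ∘ (chartAt E x₀).symm) y = 1 := by simp [h]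
  rw [e] at h2
  exact h2

theorem smoothFormAt_leftForm [FiniteDimensional ℝ E] (A : E [⋀^Fin k]→L[ℝ] ℝ) (h : H) :
    SmoothFormAt (leftForm H A) h := by
  intro x₀ hx
  have hy := (chartAt E x₀).map_source hx
  -- `B` is `A` read in the chart at `1`; this compensates for the derivative of that chart which
  -- appears in `fderiv_translated_chart`.
  set B : E [⋀^Fin k]→L[ℝ] ℝ :=
    A.compContinuousLinearMap (tderiv E E (chartAt E (1 : H)).symm (chartAt E (1 : H) 1)) with hB
  have key : chartRep (leftForm H A) x₀ =ᶠ[𝓝 (chartAt E x₀ h)] fun y =>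
      B.compContinuousLinearMap (fderiv ℝ (fun b : E => chartAt E (1 : H)
        (((chartAt E x₀).symm y)⁻¹ * (chartAt E x₀).symm b)) y) := by
    filter_upwards [(chartAt E x₀).open_target.mem_nhds hy] with y hy
    rw [fderiv_translated_chart hy, chartRep_eq, formAt_leftForm]
    have hid := tderiv_chart_symm_comp (mem_chart_source E (1 : H))
    have e : ∀ w : E, tderiv E E (chartAt E (1 : H)).symm (chartAt E (1 : H) 1)
        (tderiv E E (chartAt E (1 : H)) 1 w) = w := fun w => DFunLike.congr_fun hid w
    ext v
    simp [hB, Function.comp_def, e]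
  refine ContDiffAt.congr_of_eventuallyEq ?_ key
  refine contDiff_compContinuousLinearMap.contDiffAt.comp _ (ContDiffAt.prodMk contDiffAt_const ?_)
  exact ContDiffAt.fderiv (contDiffAt_translated_chart hy) contDiffAt_id (by simp)

variable (H) in
/-- The left-invariant vector field with value `x` at `1`, in the preferred chart at `h`. -/
def chartField (h : H) (x : E) (y : E) : E :=
  tderiv E E (chartAt E h) ((chartAt E h).symm y) (lmul E ((chartAt E h).symm y) x)

/-- Identifies `chartField` with the chart expression used in the definition of `mlieBracket`, so
that its coordinate bracket computes the bracket of the Lie algebra. -/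
theorem chartField_eq (h : H) (x : E) :
    VectorField.mpullbackWithin 𝓘(ℝ, E) 𝓘(ℝ, E) (extChartAt 𝓘(ℝ, E) h).symm
      (mulInvariantVectorField (I := 𝓘(ℝ, E)) (G := H) x) (Set.range 𝓘(ℝ, E))
      =ᶠ[𝓝 (chartAt E h h)] chartField H h x := by
  filter_upwards [(chartAt E h).open_target.mem_nhds (mem_chart_target E h)] with y hy
  have h1 := tderiv_chart_comp_symm hy
  have h2 := tderiv_chart_symm_comp ((chartAt E h).map_target hy)
  rw [(chartAt E h).right_inv hy] at h2
  have h3 := ContinuousLinearMap.inverse_eq h2 h1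
  rw [VectorField.mpullbackWithin_apply]
  have h4 : mfderivWithin 𝓘(ℝ, E) 𝓘(ℝ, E) (extChartAt 𝓘(ℝ, E) h).symm (Set.range 𝓘(ℝ, E)) y =
      tderiv E E (chartAt E h).symm y := by
    rw [ModelWithCorners.range_eq_univ, mfderivWithin_univ]; rfl
  rw [h4]
  exact DFunLike.congr_fun h3 _

theorem differentiableAt_chartField [FiniteDimensional ℝ E] (h : H) (x : E) :
    DifferentiableAt ℝ (chartField H h x) (chartAt E h h) := by
  have := lieGroup_minSmoothness (E := E) (H := H)
  have : CompleteSpace E := FiniteDimensional.complete ℝ E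
  have : IsManifold 𝓘(ℝ, E) 2 H := .of_le (n := ∞) ENat.LEInfty.out
  have h1 := MDifferentiableWithinAt.differentiableWithinAt_mpullbackWithin_vectorField
    (s := Set.univ) (x := h)
    (mdifferentiable_mulInvariantVectorField (I := 𝓘(ℝ, E)) (G := H) x h).mdifferentiableWithinAt
  rw [ModelWithCorners.range_eq_univ, Set.preimage_univ, Set.univ_inter] at h1
  have h2 := chartField_eq h x
  rw [ModelWithCorners.range_eq_univ] at h2
  exact DifferentiableAt.congr_of_eventuallyEq (differentiableWithinAt_univ.1 h1) h2.symm

omit [Group H] [LieGroup 𝓘(ℝ, E) ∞ H] in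
theorem mlieBracket_eq_tderiv [IsManifold 𝓘(ℝ, E) ∞ H]
    (V W : ∀ h : H, TangentSpace 𝓘(ℝ, E) h) (h : H) :
    VectorField.mlieBracket 𝓘(ℝ, E) V W h =
      tderiv E E (chartAt E h).symm (chartAt E h h) (VectorField.lieBracket ℝ
        (VectorField.mpullbackWithin 𝓘(ℝ, E) 𝓘(ℝ, E) (extChartAt 𝓘(ℝ, E) h).symm V
          (Set.range 𝓘(ℝ, E)))
        (VectorField.mpullbackWithin 𝓘(ℝ, E) 𝓘(ℝ, E) (extChartAt 𝓘(ℝ, E) h).symm W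
          (Set.range 𝓘(ℝ, E))) (chartAt E h h)) := by
  set A : E → E := VectorField.mpullbackWithin 𝓘(ℝ, E) 𝓘(ℝ, E) (extChartAt 𝓘(ℝ, E) h).symm V
    (Set.range 𝓘(ℝ, E))
  set B : E → E := VectorField.mpullbackWithin 𝓘(ℝ, E) 𝓘(ℝ, E) (extChartAt 𝓘(ℝ, E) h).symm W
    (Set.range 𝓘(ℝ, E))
  have h1 := tderiv_chart_comp_symm (mem_chart_target E h)
  have h2 := tderiv_chart_symm_comp (mem_chart_source E h)
  rw [(chartAt E h).left_inv (mem_chart_source E h)] at h1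
  change (tderiv E E (chartAt E h) h).inverse (VectorField.lieBracketWithin ℝ A B
    ((extChartAt 𝓘(ℝ, E) h).symm ⁻¹' Set.univ ∩ Set.range 𝓘(ℝ, E)) (chartAt E h h)) = _
  rw [ContinuousLinearMap.inverse_eq h1 h2, Set.preimage_univ, Set.univ_inter,
    ModelWithCorners.range_eq_univ, VectorField.lieBracketWithin_univ]

/-- The bracket of left-invariant fields is the left-invariant field of the bracket, transported to
the chart at `h`. -/
theorem tderiv_lieBracket_chartField [FiniteDimensional ℝ E] (h : H) (x y : E) :
    tderiv E E (chartAt E h).symm (chartAt E h h)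
      (VectorField.lieBracket ℝ (chartField H h x) (chartField H h y) (chartAt E h h)) =
      lmul E h (lieB H x y) := by
  have := lieGroup_minSmoothness (E := E) (H := H)
  have : CompleteSpace E := FiniteDimensional.complete ℝ E
  have h0 := congrFun (mulInvariantVector_mlieBracket (I := 𝓘(ℝ, E)) (G := H) x y) h
  have h1 := mlieBracket_eq_tderiv (mulInvariantVectorField (I := 𝓘(ℝ, E)) (G := H) x)
    (mulInvariantVectorField (I := 𝓘(ℝ, E)) (G := H) y) h
  have h2 := Filter.EventuallyEq.lieBracket_vectorField_eq (𝕜 := ℝ) (E := E)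
    (chartField_eq h x) (chartField_eq h y)
  exact ((congrArg _ h2).symm.trans h1.symm).trans h0.symm

/-- The exterior derivative of a left-invariant form. -/
theorem formAt_extD_leftForm [FiniteDimensional ℝ E] (A : E [⋀^Fin (k + 1)]→L[ℝ] ℝ) (h : H)
    (x : Fin (k + 2) → E) :
    formAt (extD (leftForm H A)) h (fun i => lmul E h (x i)) =
      -∑ i : Fin (k + 1), ∑ j ≥ i, (-1 : ℤ) ^ (i + j : ℕ) •
        A (Matrix.vecCons (lieB H (x i.castSucc) (x j.succ))
          (j.removeNth (i.castSucc.removeNth x))) := by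
  have hs := mem_chart_source E h
  have ht := mem_chart_target E h
  have hl := (chartAt E h).left_inv hs
  have hsym : ∀ y ∈ (chartAt E h).target, ∀ z : E,
      tderiv E E (chartAt E h).symm y (chartField H h z y) =
        lmul E ((chartAt E h).symm y) z := by
    intro y hy z
    have h2 := tderiv_chart_symm_comp ((chartAt E h).map_target hy)
    rw [(chartAt E h).right_inv hy] at h2
    exact DFunLike.congr_fun h2 _
  have hω := (smoothFormAt_leftForm A h h hs).differentiableAt (by simp)
  have e1 : ∀ i, tderiv E E (chartAt E h) h (lmul E h (x i)) =
      chartField H h (x i) (chartAt E h h) := by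
    intro i; rw [chartField, hl]
  rw [formAt_extD, ContinuousAlternatingMap.compContinuousLinearMap_apply]
  simp only [Function.comp_def, e1]
  rw [extDeriv_apply_vectorField (V := fun i => chartField H h (x i)) hω
    (fun i => differentiableAt_chartField h (x i))]
  -- A left-invariant form is constant on left-invariant fields, so the derivative terms of the
  -- invariant formula for `d` vanish and only the bracket terms remain.
  have e2 : ∀ i : Fin (k + 2), fderiv ℝ (fun y => chartRep (leftForm H A) h y
      (i.removeNth fun i => chartField H h (x i) y)) (chartAt E h h) = 0 := by
    intro i
    have : (fun y => chartRep (leftForm H A) h y (i.removeNth fun i => chartField H h (x i) y))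
        =ᶠ[𝓝 (chartAt E h h)] fun _ => A (i.removeNth x) := by
      filter_upwards [(chartAt E h).open_target.mem_nhds ht] with y hy
      rw [chartRep_eq, ContinuousAlternatingMap.compContinuousLinearMap_apply,
        ← formAt_leftForm_lmul (H := H) A ((chartAt E h).symm y)]
      congr 1
      funext j
      exact hsym y hy _
    rw [this.fderiv_eq]
    simp
  simp only [e2, zero_apply, smul_zero, Finset.sum_const_zero, zero_sub]
  congr 1
  refine Finset.sum_congr rfl fun i _ => Finset.sum_congr rfl fun j _ => ?_
  congr 1
  rw [chartRep_eq, ContinuousAlternatingMap.compContinuousLinearMap_apply, hl,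
    ← formAt_leftForm_lmul (H := H) A h]
  congr 1
  funext l
  refine Fin.cases ?_ (fun l => ?_) l
  · exact tderiv_lieBracket_chartField h _ _
  · have := hsym _ ht (x (i.castSucc.succAbove (j.succAbove l)))
    rw [hl] at this
    exact this

end LeftInvariant

/-! ### Alternating forms in degrees one, two and three -/

section Alternating
variable {E : Type*} [NormedAddCommGroup E] [NormedSpace ℝ E]
  {F : Type*} [NormedAddCommGroup F] [NormedSpace ℝ F]

/-- A bilinear map on a finite-dimensional space as a continuous bilinear map. -/
def bilinCLM [FiniteDimensional ℝ E] (B : E →ₗ[ℝ] E →ₗ[ℝ] F) : E →L[ℝ] E →L[ℝ] F :=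
  LinearMap.toContinuousLinearMap
    ((LinearMap.toContinuousLinearMap : (E →ₗ[ℝ] F) ≃ₗ[ℝ] (E →L[ℝ] F)).toLinearMap ∘ₗ B)

@[simp] theorem bilinCLM_apply [FiniteDimensional ℝ E] (B : E →ₗ[ℝ] E →ₗ[ℝ] F) (x y : E) :
    bilinCLM B x y = B x y := rfl

/-- A linear form as an alternating one-form. -/
def altOne (ℓ : E →L[ℝ] ℝ) : E [⋀^Fin 1]→L[ℝ] ℝ :=
  ContinuousAlternatingMap.ofSubsingleton ℝ E ℝ 0 ℓ

@[simp] theorem altOne_apply (ℓ : E →L[ℝ] ℝ) (v : Fin 1 → E) : altOne ℓ v = ℓ (v 0) := rfl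

/-- An alternating bilinear form as an alternating two-form. -/
def altTwo (B : E →L[ℝ] E →L[ℝ] ℝ) (hB : ∀ x, B x x = 0) : E [⋀^Fin 2]→L[ℝ] ℝ where
  toFun v := B (v 0) (v 1)
  map_update_add' := by
    intro inst m i x y
    obtain rfl : inst = instDecidableEqFin 2 := Subsingleton.elim _ _
    fin_cases i <;> simp
  map_update_smul' := by
    intro inst m i c x
    obtain rfl : inst = instDecidableEqFin 2 := Subsingleton.elim _ _
    fin_cases i <;> simp
  cont := by
    change Continuous fun v : Fin 2 → E => B (v 0) (v 1)
    fun_prop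
  map_eq_zero_of_eq' := by
    intro v i j h hij
    fin_cases i <;> fin_cases j <;> simp_all

/-- An alternating trilinear form as an alternating three-form. -/
def altThree (T : E →L[ℝ] E →L[ℝ] E →L[ℝ] ℝ) (h₁ : ∀ x y, T x x y = 0) (h₂ : ∀ x y, T x y y = 0) :
    E [⋀^Fin 3]→L[ℝ] ℝ where
  toFun v := T (v 0) (v 1) (v 2)
  map_update_add' := by
    intro inst m i x y
    obtain rfl : inst = instDecidableEqFin 3 := Subsingleton.elim _ _
    fin_cases i <;> simp
  map_update_smul' := by
    intro inst m i c x
    obtain rfl : inst = instDecidableEqFin 3 := Subsingleton.elim _ _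
    fin_cases i <;> simp
  cont := by
    change Continuous fun v : Fin 3 → E => T (v 0) (v 1) (v 2)
    fun_prop
  map_eq_zero_of_eq' := by
    intro v i j h hij
    -- Polarization: expand `T (x + y) (x + y) x = 0`.
    have h₃ : ∀ x y, T x y x = 0 := fun x y => by
      have := h₁ (x + y) x
      simp only [map_add, add_apply, h₁, h₂] at this
      simpa using this
    fin_cases i <;> fin_cases j <;> simp_all

end Alternating

/-! ### Maurer-Cartan equations, homomorphisms, adjoint representation -/

section LieAlgebra
variable {E : Type*} [NormedAddCommGroup E] [NormedSpace ℝ E]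
  {H : Type*} [TopologicalSpace H] [ChartedSpace E H] [Group H]
  {E' : Type*} [NormedAddCommGroup E'] [NormedSpace ℝ E']
  {K : Type*} [TopologicalSpace K] [ChartedSpace E' K] [Group K]
  {E'' : Type*} [NormedAddCommGroup E''] [NormedSpace ℝ E'']
  {M : Type*} [TopologicalSpace M] [ChartedSpace E'' M]
  {k : ℕ}

variable [LieGroup 𝓘(ℝ, E) ∞ H] [LieGroup 𝓘(ℝ, E') ∞ K]

section
variable [FiniteDimensional ℝ E]

/-- The Maurer-Cartan equation, tested against a linear form. -/
theorem formAt_extD_leftForm_one (A : E [⋀^Fin 1]→L[ℝ] ℝ) (h : H) (x y : E) :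
    formAt (extD (leftForm H A)) h ![lmul E h x, lmul E h y] = -A ![lieB H x y] := by
  have := formAt_extD_leftForm A h ![x, y]
  have e : (fun i => lmul E h ((![x, y] : Fin 2 → E) i)) = ![lmul E h x, lmul E h y] := by
    funext i; fin_cases i <;> rfl
  rw [e] at this
  rw [this]
  rw [show (Finset.univ : Finset (Fin (0 + 1))) = {0} from rfl, Finset.sum_singleton,
    show Finset.Ici (0 : Fin (0 + 1)) = {0} from rfl, Finset.sum_singleton]
  simp

theorem formAt_extD_leftForm_two (A : E [⋀^Fin 2]→L[ℝ] ℝ) (h : H) (x y z : E) :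
    formAt (extD (leftForm H A)) h ![lmul E h x, lmul E h y, lmul E h z] =
      -A ![lieB H x y, z] + A ![lieB H x z, y] - A ![lieB H y z, x] := by
  have := formAt_extD_leftForm A h ![x, y, z]
  have e : (fun i => lmul E h ((![x, y, z] : Fin 3 → E) i)) =
      ![lmul E h x, lmul E h y, lmul E h z] := by
    funext i; fin_cases i <;> rfl
  rw [e] at this
  rw [this]
  have h0 : Finset.Ici (0 : Fin 2) = {0, 1} := rfl
  have h1 : Finset.Ici (1 : Fin 2) = {1} := rfl
  rw [Fin.sum_univ_two, h0, h1, Finset.sum_pair (by simp), Finset.sum_singleton]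
  have e1 : (Matrix.vecCons (lieB H (![x, y, z] (0 : Fin 2).castSucc) (![x, y, z] (0 : Fin 2).succ))
      ((0 : Fin 2).removeNth ((0 : Fin 2).castSucc.removeNth ![x, y, z]))) = ![lieB H x y, z] := by
    funext i; fin_cases i <;> rfl
  have e2 : (Matrix.vecCons (lieB H (![x, y, z] (0 : Fin 2).castSucc) (![x, y, z] (1 : Fin 2).succ))
      ((1 : Fin 2).removeNth ((0 : Fin 2).castSucc.removeNth ![x, y, z]))) = ![lieB H x z, y] := by
    funext i; fin_cases i <;> rfl
  have e3 : (Matrix.vecCons (lieB H (![x, y, z] (1 : Fin 2).castSucc) (![x, y, z] (1 : Fin 2).succ))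
      ((1 : Fin 2).removeNth ((1 : Fin 2).castSucc.removeNth ![x, y, z]))) = ![lieB H y z, x] := by
    funext i; fin_cases i <;> rfl
  rw [e1, e2, e3]
  simp
  ring

end

variable (H) in
/-- The Lie bracket as a bilinear map. -/
def lieBL [FiniteDimensional ℝ E] : E →ₗ[ℝ] E →ₗ[ℝ] E :=
  have : LieGroup 𝓘(ℝ, E) (minSmoothness ℝ 3) H := lieGroup_minSmoothness
  have : CompleteSpace E := FiniteDimensional.complete ℝ E
  LinearMap.mk₂ ℝ (lieB H)
    (fun x y z => add_lie (L := GroupLieAlgebra 𝓘(ℝ, E) H) (M := GroupLieAlgebra 𝓘(ℝ, E) H) x y z)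
    (fun c x y => smul_lie (R := ℝ) (L := GroupLieAlgebra 𝓘(ℝ, E) H)
      (M := GroupLieAlgebra 𝓘(ℝ, E) H) c x y)
    (fun x y z => lie_add (L := GroupLieAlgebra 𝓘(ℝ, E) H) (M := GroupLieAlgebra 𝓘(ℝ, E) H) x y z)
    (fun c x y => lie_smul (R := ℝ) (L := GroupLieAlgebra 𝓘(ℝ, E) H)
      (M := GroupLieAlgebra 𝓘(ℝ, E) H) c x y)

@[simp] theorem lieBL_apply [FiniteDimensional ℝ E] (x y : E) : lieBL H x y = lieB H x y := rfl

theorem lieB_self [FiniteDimensional ℝ E] (x : E) : lieB H x x = 0 := by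
  have : LieGroup 𝓘(ℝ, E) (minSmoothness ℝ 3) H := lieGroup_minSmoothness
  have : CompleteSpace E := FiniteDimensional.complete ℝ E
  exact lie_self (L := GroupLieAlgebra 𝓘(ℝ, E) H) x

/-- The differential of a homomorphism of Lie groups preserves brackets. -/
theorem tderiv_lieB [FiniteDimensional ℝ E] [FiniteDimensional ℝ E'] (f : H →* K)
    (hf : ∀ x, SmoothAt E E' f x) (x y : E) :
    tderiv E E' f 1 (lieB H x y) = lieB K (tderiv E E' f 1 x) (tderiv E E' f 1 y) := by
  -- Linear forms separate points, and for each one the claim is naturality of `d` applied to the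
  -- corresponding left-invariant one-form: both sides are given by the Maurer-Cartan equation.
  refine (SeparatingDual.eq_iff_forall_dual_eq (R := ℝ)).2 fun ℓ => ?_
  have h1 := formAt_extD_pullback (x := 1) (smoothFormAt_leftForm (H := K) (altOne ℓ) (f 1)) (hf 1)
  rw [pullback_hom_leftForm f (fun x => (hf x).tdiff)] at h1
  have h2 := DFunLike.congr_fun h1 ![lmul E (1 : H) x, lmul E (1 : H) y]
  rw [formAt_extD_leftForm_one, formAt_pullback_apply, map_one] at h2
  have e : (fun i => tderiv E E' f 1 ((![lmul E (1 : H) x, lmul E (1 : H) y] : Fin 2 → E) i)) =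
      ![lmul E' (1 : K) (tderiv E E' f 1 x), lmul E' (1 : K) (tderiv E E' f 1 y)] := by
    funext i; fin_cases i <;> simp
  rw [e, formAt_extD_leftForm_one] at h2
  simpa using h2

/-- The product rule. -/
theorem tderiv_mul {u v : M → H} {m : M} (hu : TDiffAt E'' E u m) (hv : TDiffAt E'' E v m)
    (a : E'') : tderiv E'' E (fun y => u y * v y) m a =
      tderiv E E (fun z : H => z * v m) (u m) (tderiv E'' E u m a) +
      tderiv E E (fun z : H => u m * z) (v m) (tderiv E'' E v m a) := by
  have hmul : MDifferentiableAt (𝓘(ℝ, E).prod 𝓘(ℝ, E)) 𝓘(ℝ, E) (fun p : H × H => p.1 * p.2)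
      (u m, v m) :=
    (contMDiff_mul 𝓘(ℝ, E) ∞).mdifferentiableAt (by simp)
  have h1 := mfderiv_comp_apply m (g := fun p : H × H => p.1 * p.2) (f := fun y => (u y, v y)) hmul
    (hu.prodMk hv) a
  have h2 : mfderiv 𝓘(ℝ, E'') (𝓘(ℝ, E).prod 𝓘(ℝ, E)) (fun y => (u y, v y)) m a =
      (tderiv E'' E u m a, tderiv E'' E v m a) := by
    rw [mfderiv_prodMk hu hv]; rfl
  rw [h2] at h1
  exact h1.trans (mfderiv_prod_eq_add_apply (v := (tderiv E'' E u m a, tderiv E'' E v m a)) hmul)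

/-! ### The adjoint representation -/

variable (E) in
/-- The adjoint representation on the model space. -/
def adE (g : H) : E →L[ℝ] E := tderiv E E (fun x : H => g * x * g⁻¹) 1

theorem smoothAt_conj (g x : H) : SmoothAt E E (fun x : H => g * x * g⁻¹) x :=
  (smoothAt_mul_right g⁻¹ (g * x)).comp x (smoothAt_mul_left g x)

theorem adE_mul (g h : H) (x : E) : adE E (g * h) x = adE E g (adE E h x) := by
  have := tderiv_comp_apply (g := fun x : H => g * x * g⁻¹) (f := fun x : H => h * x * h⁻¹)
    (x := 1) (smoothAt_conj g _).tdiff (smoothAt_conj h _).tdiff x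
  simp only [mul_one, mul_inv_cancel] at this
  rw [adE, adE, adE, ← this]
  simp only [mul_inv_rev, mul_assoc]

omit [LieGroup 𝓘(ℝ, E) ∞ H] in
@[simp] theorem adE_one (x : E) : adE E (1 : H) x = x := by
  simp [adE]

@[simp] theorem adE_inv_adE (g : H) (x : E) : adE E g⁻¹ (adE E g x) = x := by
  rw [← adE_mul, inv_mul_cancel, adE_one]

@[simp] theorem adE_adE_inv (g : H) (x : E) : adE E g (adE E g⁻¹ x) = x := by
  rw [← adE_mul, mul_inv_cancel, adE_one]

theorem adE_lieB [FiniteDimensional ℝ E] (g : H) (x y : E) :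
    adE E g (lieB H x y) = lieB H (adE E g x) (adE E g y) :=
  tderiv_lieB (MulAut.conj g).toMonoidHom (fun x => smoothAt_conj g x) x y

theorem tderiv_hom_adE (f : H →* K) (hf : ∀ x, TDiffAt E E' f x) (g : H) (x : E) :
    tderiv E E' f 1 (adE E g x) = adE E' (f g) (tderiv E E' f 1 x) := by
  have h1 := tderiv_comp_apply (g := f) (f := fun x : H => g * x * g⁻¹) (x := 1)
    (hf _) (smoothAt_conj g _).tdiff x
  have h2 := tderiv_comp_apply (g := fun x : K => f g * x * (f g)⁻¹) (f := f) (x := 1)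
    (smoothAt_conj _ _).tdiff (hf _) x
  simp only [map_mul, map_inv, mul_one, mul_inv_cancel] at h1
  rw [map_one] at h2
  exact h1.symm.trans h2

/-- From `y a = a (a⁻¹ y a)`. -/
theorem tderiv_mul_right (a : H) (x : E) :
    tderiv E E (fun y : H => y * a) 1 x = lmul E a (adE E a⁻¹ x) := by
  have h1 := tderiv_comp_apply (g := fun x : H => a * x) (f := fun x : H => a⁻¹ * x * a⁻¹⁻¹)
    (x := 1) (smoothAt_mul_left a _).tdiff (smoothAt_conj _ _).tdiff x
  simp only [mul_one, mul_inv_cancel, ← mul_assoc, one_mul, inv_inv, inv_mul_cancel] at h1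
  rw [h1, lmul, adE, inv_inv]

/-- Differentiate `y y⁻¹ = 1` by the product rule. -/
theorem tderiv_inv_one (x : E) : tderiv E E (fun y : H => y⁻¹) 1 x = -x := by
  have hinv : SmoothAt E E (fun y : H => y⁻¹) 1 := (contMDiff_inv 𝓘(ℝ, E) ∞).contMDiffAt
  have h1 := tderiv_mul (E := E) (u := fun y : H => y) (v := fun y : H => y⁻¹) (m := 1)
    (E'' := E) mdifferentiableAt_id hinv.tdiff x
  simp at h1
  rw [eq_neg_iff_add_eq_zero, add_comm]
  exact h1.symm

end LieAlgebra

/-! ### Integral curves of left-invariant fields; closedness of biinvariant forms -/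

section Curves
variable {E : Type*} [NormedAddCommGroup E] [NormedSpace ℝ E] [FiniteDimensional ℝ E]
  {H : Type*} [TopologicalSpace H] [ChartedSpace E H] [Group H] [LieGroup 𝓘(ℝ, E) ∞ H]
  {E' : Type*} [NormedAddCommGroup E'] [NormedSpace ℝ E']
  {M : Type*} [TopologicalSpace M] [ChartedSpace E' M]
  {k : ℕ}

/-- `γ` is, near `0`, an integral curve through `1` of the left-invariant vector field of `x`. -/
def IsLeftCurve (γ : ℝ → H) (x : E) : Prop :=
  γ 0 = 1 ∧ IsMIntegralCurveAt γ (mulInvariantVectorField (I := 𝓘(ℝ, E)) (G := H) x) 0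

omit [FiniteDimensional ℝ E] in
variable (H) in
theorem contMDiff_leftField (x : E) (h : H) :
    ContMDiffAt 𝓘(ℝ, E) 𝓘(ℝ, E).tangent 1 (fun g : H =>
      (mulInvariantVectorField (I := 𝓘(ℝ, E)) (G := H) x g : TangentBundle 𝓘(ℝ, E) H)) h := by
  have := lieGroup_minSmoothness (E := E) (H := H)
  exact (contMDiffAt_mulInvariantVectorField (I := 𝓘(ℝ, E)) (G := H) x).of_le (by simp)

variable (H) in
theorem exists_isLeftCurve (x : E) : ∃ γ : ℝ → H, IsLeftCurve γ x := by
  have : CompleteSpace E := FiniteDimensional.complete ℝ E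
  have : IsManifold 𝓘(ℝ, E) 1 H := .of_le (n := ∞) (by simp)
  obtain ⟨γ, h0, h1⟩ := exists_isMIntegralCurveAt_of_contMDiffAt_boundaryless 0
    (contMDiff_leftField H x (1 : H))
  exact ⟨γ, h0, h1⟩

omit [FiniteDimensional ℝ E] [LieGroup 𝓘(ℝ, E) ∞ H] in
theorem IsLeftCurve.eventually {γ : ℝ → H} {x : E} (hγ : IsLeftCurve γ x) :
    ∀ᶠ t in 𝓝 (0 : ℝ), TDiffAt ℝ E γ t ∧ tderiv ℝ E γ t 1 = lmul E (γ t) x := by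
  filter_upwards [hγ.2] with t ht
  refine ⟨ht.mdifferentiableAt, ?_⟩
  have h1 : tderiv ℝ E γ t = (1 : ℝ →L[ℝ] ℝ).smulRight (lmul E (γ t) x) := ht.mfderiv
  simp [h1]

omit [FiniteDimensional ℝ E] in
theorem tderiv_hom_lmul {K : Type*} [TopologicalSpace K] [ChartedSpace E' K] [Group K]
    [LieGroup 𝓘(ℝ, E') ∞ K] (f : H →* K) (hf : ∀ x, TDiffAt E E' f x) (h : H) (x : E) :
    tderiv E E' f h (lmul E h x) = lmul E' (f h) (tderiv E E' f 1 x) := by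
  have := mc_tderiv_hom f hf h (lmul E h x)
  rw [mc_lmul] at this
  rw [← this, lmul_mc]

/-- A homomorphism carries the left-invariant field of `x` to that of its image under the
differential, here again `x`. So `σ ∘ γ` is an integral curve of the same field with the same
initial value, and uniqueness applies. -/
theorem IsLeftCurve.eventually_fixed {γ : ℝ → H} {x : E} (hγ : IsLeftCurve γ x) (σ : H →* H)
    (hσ : ∀ x, TDiffAt E E σ x) (hx : tderiv E E σ 1 x = x) :
    ∀ᶠ t in 𝓝 (0 : ℝ), σ (γ t) = γ t := by
  have : CompleteSpace E := FiniteDimensional.complete ℝ E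
  have : IsManifold 𝓘(ℝ, E) 1 H := .of_le (n := ∞) (by simp)
  refine isMIntegralCurveAt_eventuallyEq_of_contMDiffAt_boundaryless (γ := σ ∘ γ)
    (contMDiff_leftField H x _) ?_ hγ.2 (by simp [hγ.1])
  filter_upwards [hγ.2] with t ht
  have h1 := (hσ (γ t)).hasMFDerivAt.comp t ht
  have h2 : (tderiv E E σ (γ t)).comp ((1 : ℝ →L[ℝ] ℝ).smulRight (lmul E (γ t) x)) =
      (1 : ℝ →L[ℝ] ℝ).smulRight (lmul E (σ (γ t)) x) := by
    ext
    simp [tderiv_hom_lmul σ hσ, hx]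
  exact h1.congr_mfderiv h2

/-- A curve with vanishing derivative near `0` is locally constant. -/
theorem eventually_eq_of_tderiv_zero [IsManifold 𝓘(ℝ, E') ∞ M] {c : ℝ → M}
    (hc : ∀ᶠ t in 𝓝 (0 : ℝ), TDiffAt ℝ E' c t ∧ tderiv ℝ E' c t 1 = 0) :
    ∀ᶠ t in 𝓝 (0 : ℝ), c t = c 0 := by
  set φ := chartAt E' (c 0)
  have hc0 : ContinuousAt c 0 := hc.self_of_nhds.1.continuousAt
  have hsrc := hc0.eventually (φ.open_source.mem_nhds (mem_chart_source E' (c 0)))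
  obtain ⟨ε, hε, hball⟩ := Metric.eventually_nhds_iff_ball.1 (hc.and hsrc)
  have hd : ∀ t ∈ Metric.ball (0 : ℝ) ε, HasDerivAt (fun t => φ (c t)) 0 t := by
    intro t ht
    obtain ⟨⟨h1, h2⟩, h3⟩ := hball t ht
    have hφ := (smoothAt_chart h3).tdiff
    have h4 := tderiv_comp_apply (g := φ) (f := c) hφ h1 1
    rw [h2, map_zero, tderiv_eq_fderiv] at h4
    have h5 : DifferentiableAt ℝ (fun t => φ (c t)) t :=
      (MDifferentiableAt.comp t hφ h1).differentiableAt
    rw [← h4]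
    exact h5.hasDerivAt
  filter_upwards [Metric.ball_mem_nhds (0 : ℝ) hε] with t ht
  have h0 : (0 : ℝ) ∈ Metric.ball (0 : ℝ) ε := Metric.mem_ball_self hε
  have hconst := (convex_ball (0 : ℝ) ε).is_const_of_fderivWithin_eq_zero (𝕜 := ℝ)
    (f := fun t => φ (c t)) (fun t ht => (hd t ht).differentiableAt.differentiableWithinAt)
    (fun t ht => by
      rw [fderivWithin_of_isOpen Metric.isOpen_ball ht, (hd t ht).hasFDerivAt.fderiv]
      ext; simp) ht h0
  exact φ.injOn (hball t ht).2 (hball 0 h0).2 hconst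

omit [FiniteDimensional ℝ E] [LieGroup 𝓘(ℝ, E) ∞ H] in
/-- If the derivative of `f` kills the left-invariant field of `x`, then `f` is constant along the
integral curve of `x`. -/
theorem IsLeftCurve.eventually_eq [IsManifold 𝓘(ℝ, E') ∞ M] {γ : ℝ → H} {x : E}
    (hγ : IsLeftCurve γ x) {f : H → M} (hf : ∀ h, TDiffAt E E' f h)
    (hx : ∀ h, tderiv E E' f h (lmul E h x) = 0) :
    ∀ᶠ t in 𝓝 (0 : ℝ), f (γ t) = f 1 := by
  have := eventually_eq_of_tderiv_zero (c := fun t => f (γ t)) (E' := E') (by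
    filter_upwards [hγ.eventually] with t ht
    refine ⟨MDifferentiableAt.comp t (hf _) ht.1, ?_⟩
    rw [tderiv_comp_apply (hf _) ht.1, ht.2, hx])
  simpa [hγ.1] using this

omit [FiniteDimensional ℝ E] [LieGroup 𝓘(ℝ, E) ∞ H] in
/-- The derivative of a map at `1` kills `x` if the map is constant along the integral curve. -/
theorem IsLeftCurve.tderiv_eq_zero {γ : ℝ → H} {x : E} (hγ : IsLeftCurve γ x) {f : H → M}
    (hf : TDiffAt E E' f 1) {m : M} (h : ∀ᶠ t in 𝓝 (0 : ℝ), f (γ t) = m) :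
    tderiv E E' f 1 x = 0 := by
  obtain ⟨h1, h2⟩ := hγ.eventually.self_of_nhds
  have h3 := tderiv_comp_apply (g := f) (f := γ) (x := 0) (by rw [hγ.1]; exact hf) h1 1
  rw [h2, hγ.1, lmul_one] at h3
  have h4 : tderiv ℝ E' (fun t => f (γ t)) 0 = tderiv ℝ E' (fun _ : ℝ => m) 0 := tderiv_congr h
  rw [← h3, h4, tderiv_const]
  rfl

omit [FiniteDimensional ℝ E] in
theorem map_neg_univ (A : E [⋀^Fin k]→L[ℝ] ℝ) (v : Fin k → E) :
    A (fun i => -v i) = (-1) ^ k * A v := by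
  have := A.toMultilinearMap.map_smul_univ (fun _ => (-1 : ℝ)) v
  simpa using this

omit [FiniteDimensional ℝ E] in
-- Differentiate `(h y)⁻¹ = y⁻¹ h⁻¹` at `y = 1`. Up to left translation, inversion acts as `-Ad_h`.
theorem tderiv_inv_lmul (h : H) (x : E) :
    tderiv E E (fun y : H => y⁻¹) h (lmul E h x) = lmul E h⁻¹ (-adE E h x) := by
  have hinv : ∀ a : H, TDiffAt E E (fun y : H => y⁻¹) a := fun a =>
    (contMDiff_inv 𝓘(ℝ, E) ∞).mdifferentiableAt (by simp)
  have h1 := tderiv_comp_apply (g := fun y : H => y⁻¹) (f := fun y : H => h * y) (x := 1)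
    (hinv _) (smoothAt_mul_left _ _).tdiff x
  have h2 := tderiv_comp_apply (g := fun y : H => y * h⁻¹) (f := fun y : H => y⁻¹) (x := 1)
    (smoothAt_mul_right _ _).tdiff (hinv _) x
  simp only [mul_inv_rev, mul_one, inv_one] at h1 h2
  rw [h1, tderiv_inv_one, tderiv_mul_right, inv_inv, map_neg] at h2
  exact h2

theorem formAt_extD_leftForm_lmul (A : E [⋀^Fin k]→L[ℝ] ℝ) (h : H) (x : Fin (k + 1) → E) :
    formAt (extD (leftForm H A)) h (fun i => lmul E h (x i)) =
      formAt (extD (leftForm H A)) 1 x := by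
  have h1 := formAt_extD_pullback (x := (1 : H)) (f := fun y : H => h * y)
    (smoothFormAt_leftForm A _) (smoothAt_mul_left h 1)
  rw [pullback_mul_left_leftForm] at h1
  have h2 := DFunLike.congr_fun h1 x
  rw [h2, formAt_pullback_apply, mul_one]
  rfl

/-- A biinvariant form of odd degree is closed. -/
theorem extD_leftForm_eq_zero (hk : Odd k) (A : E [⋀^Fin k]→L[ℝ] ℝ)
    (hA : ∀ (g : H) (v : Fin k → E), A (fun i => adE E g (v i)) = A v) :
    extD (leftForm H A) = 0 := by
  have hinv : SmoothAt E E (fun y : H => y⁻¹) 1 := (contMDiff_inv 𝓘(ℝ, E) ∞).contMDiffAt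
  -- Inversion acts through `-Ad_h`; the `Ad_h` disappears by invariance and the sign survives
  -- because `k` is odd.
  have h1 : pullback (fun y : H => y⁻¹) (leftForm H A) = -leftForm H A := by
    refine formAt_ext fun h => ?_
    ext v
    obtain ⟨x, rfl⟩ : ∃ x : Fin k → E, (fun i => lmul E h (x i)) = v :=
      ⟨fun i => mc E h (v i), by simp⟩
    rw [formAt_pullback_apply]
    simp only [tderiv_inv_lmul, formAt_leftForm_lmul, map_neg_univ, hA, hk.neg_one_pow]
    have : formAt (-leftForm H A) h (fun i => lmul E h (x i)) =
      -formAt (leftForm H A) h (fun i => lmul E h (x i)) := rfl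
    rw [this, formAt_leftForm_lmul]
    ring
  have h2 := formAt_extD_pullback (x := (1 : H)) (f := fun y : H => y⁻¹)
    (smoothFormAt_leftForm A _) hinv
  rw [h1, formAt_extD_neg] at h2
  -- By naturality, inversion pulls `dα` back to `-dα`. At `1` its differential is `-1`, which acts
  -- trivially on forms of the even degree `k + 1`; so `dα = -dα` there.
  have h3 : ∀ v, formAt (extD (leftForm H A)) 1 v = 0 := by
    intro v
    have h4 := DFunLike.congr_fun h2 v
    rw [formAt_pullback_apply, inv_one] at h4
    simp only [tderiv_inv_one, map_neg_univ, hk.add_one.neg_one_pow, one_mul,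
      ContinuousAlternatingMap.neg_apply] at h4
    linarith
  refine formAt_ext fun h => ?_
  ext v
  obtain ⟨x, rfl⟩ : ∃ x : Fin (k + 1) → E, (fun i => lmul E h (x i)) = v :=
    ⟨fun i => mc E h (v i), by simp⟩
  rw [formAt_extD_leftForm_lmul, h3]
  rfl

end Curves

/-! ### Linear algebra of Legendrian forms -/

section Legendrian
variable {E : Type*} [NormedAddCommGroup E] [NormedSpace ℝ E] [FiniteDimensional ℝ E]
  {H : Type*} [TopologicalSpace H] [ChartedSpace E H] [Group H] [LieGroup 𝓘(ℝ, E) ∞ H]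

variable (H) in
/-- The infinitesimal data of a Legendrian symmetric pair, on the model space. -/
structure LegendrianData (s : E →L[ℝ] E) (Λ : E →ₗ[ℝ] E →ₗ[ℝ] ℝ) : Prop where
  symm : ∀ x y, Λ x y = Λ y x
  nondegenerate : ∀ x, (∀ y, Λ x y = 0) → x = 0
  skew : ∀ x y, Λ (s x) y = -Λ x (s y)
  ad_invariant : ∀ x y z, Λ (lieB H x y) z = -Λ y (lieB H x z)
  Ad_invariant : ∀ (h : H) (x y : E), Λ (adE E h x) y = Λ x (adE E h⁻¹ y)
  invol : ∀ x, s (s x) = x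
  map_lie : ∀ x y, s (lieB H x y) = lieB H (s x) (s y)

/-- The projection to the `-1` eigenspace of `s`. -/
def proj (s : E →L[ℝ] E) (x : E) : E := (1 / 2 : ℝ) • (x - s x)

variable {s : E →L[ℝ] E} {Λ : E →ₗ[ℝ] E →ₗ[ℝ] ℝ} (D : LegendrianData H s Λ)
include D

/-- Invariance under `ad x` applied to `[x, x] = 0`. Polarizing this gives the complete antisymmetry
of `Λ(x, [y, z])` used below. -/
theorem LegendrianData.lie_right_self (x y : E) : Λ x (lieB H x y) = 0 := by
  have h := D.ad_invariant x x y
  rw [lieB_self, map_zero, LinearMap.zero_apply] at h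
  linarith

theorem LegendrianData.lie_cyclic (x y z : E) : Λ x (lieB H y z) = Λ y (lieB H z x) := by
  have h := D.lie_right_self (x + y) z
  simp only [← lieBL_apply, map_add, LinearMap.add_apply] at h
  simp only [lieBL_apply, D.lie_right_self] at h
  have h2 : lieB H z x = -lieB H x z := by
    have := lieB_self (H := H) (x + z)
    simp only [← lieBL_apply, map_add, LinearMap.add_apply] at this
    simp only [lieBL_apply, lieB_self] at this
    rw [eq_neg_iff_add_eq_zero]
    simpa using this
  rw [h2, map_neg]
  linarith

theorem LegendrianData.lie_swap (x y z : E) : Λ x (lieB H y z) = -Λ y (lieB H x z) := by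
  have h := D.lie_right_self (x + y) z
  simp only [← lieBL_apply, map_add, LinearMap.add_apply] at h
  simp only [lieBL_apply, D.lie_right_self] at h
  linarith

omit [FiniteDimensional ℝ E] [LieGroup 𝓘(ℝ, E) ∞ H] in
theorem LegendrianData.skew_apply (x y : E) : Λ (s x) (s y) = -Λ x y := by
  rw [D.skew, D.invol]

omit [FiniteDimensional ℝ E] [LieGroup 𝓘(ℝ, E) ∞ H] in
theorem LegendrianData.isotropic {x y : E} (hx : s x = x) (hy : s y = y) : Λ x y = 0 := by
  have h := D.skew_apply x y
  rw [hx, hy] at h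
  linarith

omit [FiniteDimensional ℝ E] [LieGroup 𝓘(ℝ, E) ∞ H] in
theorem LegendrianData.isotropic_neg {x y : E} (hx : s x = -x) (hy : s y = -y) : Λ x y = 0 := by
  have h := D.skew_apply x y
  rw [hx, hy, map_neg, map_neg, LinearMap.neg_apply] at h
  linarith

omit [FiniteDimensional ℝ E] [LieGroup 𝓘(ℝ, E) ∞ H] in
theorem LegendrianData.map_proj (x : E) : s (proj s x) = -proj s x := by
  simp only [proj, map_smul, map_sub, D.invol]
  rw [← smul_neg, neg_sub]

/-- The inclusion `[𝔭, 𝔭] ⊆ 𝔥^s`: the two signs cancel. -/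
theorem LegendrianData.map_lie_proj (x y : E) :
    s (lieB H (proj s x) (proj s y)) = lieB H (proj s x) (proj s y) := by
  rw [D.map_lie, D.map_proj, D.map_proj]
  simp only [← lieBL_apply, map_neg, LinearMap.neg_apply, neg_neg]

omit [FiniteDimensional ℝ E] [LieGroup 𝓘(ℝ, E) ∞ H] in
theorem LegendrianData.map_sub_proj (x : E) : s (x - proj s x) = x - proj s x := by
  simp only [proj, map_smul, map_sub, D.invol]
  module

omit [FiniteDimensional ℝ E] [LieGroup 𝓘(ℝ, E) ∞ H] in
/-- Pairing with a fixed vector only sees the `-1` component. -/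
theorem LegendrianData.proj_left {x y : E} (hy : s y = y) : Λ (proj s x) y = Λ x y := by
  have h := D.isotropic (D.map_sub_proj x) hy
  rw [map_sub, LinearMap.sub_apply] at h
  linarith

omit [FiniteDimensional ℝ E] [LieGroup 𝓘(ℝ, E) ∞ H] in
-- Symmetry of `Λ` and skewness of `s` together force `Λ x (s x) = 0`.
theorem LegendrianData.apply_proj_self {x : E} (hx : Λ x x = 0) : Λ x (proj s x) = 0 := by
  have h := D.skew x x
  rw [D.symm (s x) x] at h
  simp only [proj, map_smul, map_sub, hx, smul_eq_mul]
  linarith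

omit [FiniteDimensional ℝ E] [LieGroup 𝓘(ℝ, E) ∞ H] in
/-- A vector orthogonal to the fixed space of `s` is fixed by `s`. -/
theorem LegendrianData.fixed_of_orthogonal {x : E} (h : ∀ y, s y = y → Λ x y = 0) : s x = x := by
  have h0 : proj s x = 0 := by
    refine D.nondegenerate _ fun y => ?_
    -- Split `y` into eigencomponents: the hypothesis handles the `+1` part, isotropy of the `-1`
    -- eigenspace the other.
    have h1 : Λ (proj s x) (y - proj s y) = 0 := by
      rw [D.proj_left (D.map_sub_proj y)]
      exact h _ (D.map_sub_proj y)
    rw [map_sub, D.isotropic_neg (D.map_proj x) (D.map_proj y), sub_zero] at h1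
    exact h1
  have h1 := D.map_sub_proj x
  rwa [h0, sub_zero] at h1

theorem LegendrianData.lie_left (x y z : E) : Λ (lieB H x y) z = Λ x (lieB H y z) := by
  rw [D.ad_invariant, ← D.lie_swap]

theorem LegendrianData.lie_right_swap (x y z : E) : Λ x (lieB H z y) = -Λ x (lieB H y z) := by
  rw [D.lie_cyclic x y z, D.lie_swap x z y, D.symm z, D.lie_left, D.symm x, D.lie_left]

/-- Write `T` for the trilinear form `Λ(x, [y, z])`, and expand each projection as `(1 - s)/2`.
Applying `s` to all three arguments changes the sign of `T`, so terms with two copies of `s` are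
minus terms with one. Both sides then equal `-½` times the sum of the three terms with one `s`, up
to multiples of `T(a, b, c)`. These multiples differ, which is why `h0` is needed. -/
theorem LegendrianData.cocycle {a b c : E} (h0 : Λ a (lieB H b c) = 0) :
    2 * Λ (proj s a) (lieB H (proj s b) (proj s c)) =
      -(-Λ (lieB H a b) (proj s c) + Λ (lieB H a c) (proj s b) - Λ (lieB H b c) (proj s a)) := by
  have hs : ∀ x y z, Λ (s x) (lieB H (s y) (s z)) = -Λ x (lieB H y z) := fun x y z => by
    rw [← D.map_lie, D.skew_apply]
  have h1 : Λ (s a) (lieB H (s b) c) = -Λ a (lieB H b (s c)) := by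
    rw [← hs a b (s c), D.invol]
  have h2 : Λ (s a) (lieB H b (s c)) = -Λ a (lieB H (s b) c) := by
    rw [← hs a (s b) c, D.invol]
  have h3 : Λ a (lieB H (s b) (s c)) = -Λ (s a) (lieB H b c) := by
    rw [← hs (s a) b c, D.invol]
  have h4 := hs a b c
  have e2 : ∀ y, Λ (lieB H a c) y = -Λ a (lieB H y c) := fun y => by
    rw [D.lie_left, D.lie_right_swap]
  have e3 : ∀ y, Λ (lieB H b c) y = Λ y (lieB H b c) := fun y => D.symm _ _
  rw [D.lie_left, e2, e3]
  simp only [proj, map_smul, map_sub, ← lieBL_apply, LinearMap.sub_apply, LinearMap.smul_apply,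
    smul_eq_mul] at *
  linarith

end Legendrian

/-! ### Symmetric pairs: the Lie algebra of the subgroup -/

section SymmetricPair
variable {EH : Type*} [NormedAddCommGroup EH] [NormedSpace ℝ EH]
  {EG : Type*} [NormedAddCommGroup EG] [NormedSpace ℝ EG]
  {EP : Type*} [NormedAddCommGroup EP] [NormedSpace ℝ EP]
  {H : Type*} [TopologicalSpace H] [ChartedSpace EH H] [Group H]
  {G : Subgroup H} [ChartedSpace EG G]
  {σ : H →* H}

variable (EH EG G) in
/-- The inclusion of Lie algebras `𝔤 → 𝔥` on the model spaces. -/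
def inc : EG →L[ℝ] EH := tderiv EG EH (Subtype.val : G → H) 1

variable (EH σ) in
/-- The differential of the involution on the model space. -/
def invDiff : EH →L[ℝ] EH := tderiv EH EH σ 1

theorem IsSymmetricPair.smoothAt (hσ : IsSymmetricPair EH σ G) (h : H) : SmoothAt EH EH σ h :=
  hσ.smooth.contMDiffAt

theorem IsSymmetricPair.tdiff (hσ : IsSymmetricPair EH σ G) (h : H) : TDiffAt EH EH σ h :=
  (hσ.smoothAt h).tdiff

variable [LieGroup 𝓘(ℝ, EH) ∞ H]

theorem IsSymmetricPair.legendrianData [FiniteDimensional ℝ EH] (hσ : IsSymmetricPair EH σ G)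
    {Λ : EH →ₗ[ℝ] EH →ₗ[ℝ] ℝ}
    (hΛ : IsLegendrianStructure σ (Λ : LinearMap.BilinForm ℝ (GroupLieAlgebra 𝓘(ℝ, EH) H))) :
    LegendrianData H (invDiff EH σ) Λ where
  symm := hΛ.symm
  nondegenerate := hΛ.nondegenerate.1
  skew := hΛ.skew
  ad_invariant := hΛ.ad_invariant
  Ad_invariant := hΛ.Ad_invariant
  invol x := by
    have h := tderiv_comp_apply (g := σ) (f := σ) (x := 1) (hσ.tdiff _) (hσ.tdiff _) x
    simp only [hσ.involutive, map_one] at h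
    rw [invDiff, ← h]
    exact DFunLike.congr_fun (tderiv_id (1 : H)) x
  map_lie x y := tderiv_lieB σ hσ.smoothAt x y

variable [LieGroup 𝓘(ℝ, EG) ∞ G]
  (hG : Manifold.IsSmoothEmbedding 𝓘(ℝ, EG) 𝓘(ℝ, EH) ∞ (Subtype.val : G → H))
  (hσ : IsSymmetricPair EH σ G)

include hG in
omit [LieGroup 𝓘(ℝ, EH) ∞ H] [LieGroup 𝓘(ℝ, EG) ∞ G] in
theorem smoothAt_val (g : G) : SmoothAt EG EH (Subtype.val : G → H) g :=
  hG.isImmersion.contMDiff.contMDiffAt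

include hG hσ in
omit [LieGroup 𝓘(ℝ, EH) ∞ H] [LieGroup 𝓘(ℝ, EG) ∞ G] in
theorem invDiff_inc (ξ : EG) : invDiff EH σ (inc EH EG G ξ) = inc EH EG G ξ := by
  have h := tderiv_comp_apply (g := σ) (f := (Subtype.val : G → H)) (x := 1) (hσ.tdiff _)
    (smoothAt_val hG 1).tdiff ξ
  have h1 : (fun y : G => σ (y : H)) = Subtype.val := funext fun y => hσ.subset_fixed y y.2
  rw [h1] at h
  exact h.symm

include hG hσ in
/-- The fixed space of the involution is the Lie algebra of `G`. -/
theorem exists_inc_eq [FiniteDimensional ℝ EH] [FiniteDimensional ℝ EG] {x : EH}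
    (hx : invDiff EH σ x = x) : ∃ ξ, inc EH EG G ξ = x := by
  -- The integral curve of `x` consists of fixed points of `σ` and is connected near `0`, so it
  -- stays in the identity component of `H^σ`, hence in `G`.
  obtain ⟨γ, hγ⟩ := exists_isLeftCurve H x
  obtain ⟨ε, hε, hball⟩ := Metric.eventually_nhds_iff_ball.1
    ((hγ.eventually_fixed σ hσ.tdiff hx).and hγ.eventually)
  have hcont : ContinuousOn γ (Metric.ball 0 ε) := fun t ht =>
    (hball t ht).2.1.continuousAt.continuousWithinAt
  have hpre : IsPreconnected (γ '' Metric.ball 0 ε) :=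
    (convex_ball (0 : ℝ) ε).isPreconnected.image γ hcont
  have h0 : (0 : ℝ) ∈ Metric.ball (0 : ℝ) ε := Metric.mem_ball_self hε
  have hmem : ∀ t ∈ Metric.ball (0 : ℝ) ε, γ t ∈ G := fun t ht =>
    hσ.identity_component_subset <| (hpre.subset_connectedComponentIn ⟨0, h0, hγ.1⟩
      (by rintro _ ⟨u, hu, rfl⟩; exact (hball u hu).1)) ⟨t, ht, rfl⟩
  -- A curve in `H` with values in `G` must be shown differentiable as a curve in `G`. The local
  -- retraction does this; it equals the identity near `1` in the subspace topology, so it fixes the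
  -- points of `γ`.
  obtain ⟨r, hr, hr'⟩ := exists_smooth_retraction hG.isImmersion (1 : G)
  have hev : ∀ᶠ t in 𝓝 (0 : ℝ), (Subtype.val : G → H) (r (γ t)) = γ t := by
    rw [nhds_subtype_eq_comap, eventually_comap] at hr'
    have hγc : ContinuousAt γ 0 := (hball 0 h0).2.1.continuousAt
    have h1 : Tendsto γ (𝓝 0) (𝓝 ((1 : G) : H)) := by
      have := hγc.tendsto
      rwa [hγ.1] at this
    filter_upwards [h1.eventually hr', Metric.ball_mem_nhds 0 hε] with t ht htb
    rw [ht ⟨γ t, hmem t htb⟩ rfl]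
  have hr1 : r 1 = 1 := hr'.self_of_nhds
  have hd := (hball 0 h0).2
  rw [hγ.1, lmul_one] at hd
  have e1 : tderiv ℝ EH (fun t => ((r (γ t) : G) : H)) 0 1 = x := by
    rw [tderiv_congr hev, hd.2]
  have hr2 : TDiffAt EH EG r (γ 0) := by rw [hγ.1]; exact hr.tdiff
  have h2 := tderiv_comp_apply (E'' := EH) (g := (Subtype.val : G → H)) (f := fun t => r (γ t))
    (x := (0 : ℝ)) (smoothAt_val hG _).tdiff (hr2.comp 0 hd.1) (1 : ℝ)
  have h3 : r (γ 0) = 1 := by rw [hγ.1, hr1]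
  rw [h3] at h2
  exact ⟨_, h2.symm.trans e1⟩

include hG in
theorem inc_lieB [FiniteDimensional ℝ EH] [FiniteDimensional ℝ EG] (ξ η : EG) :
    inc EH EG G (lieB G ξ η) = lieB H (inc EH EG G ξ) (inc EH EG G η) :=
  tderiv_lieB G.subtype (smoothAt_val hG) ξ η

include hG in
theorem inc_adE (g : G) (ξ : EG) : inc EH EG G (adE EG g ξ) = adE EH (g : H) (inc EH EG G ξ) :=
  tderiv_hom_adE G.subtype (fun x => (smoothAt_val hG x).tdiff) g ξ

/-! ### The Cartan map -/

variable (σ) in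
/-- The Cartan map `h ↦ σ(h) h⁻¹`. -/
def cartan (h : H) : H := σ h * h⁻¹

include hσ

theorem smoothAt_cartan (h : H) : SmoothAt EH EH (cartan σ) h :=
  (hσ.smoothAt h).mul (contMDiff_inv 𝓘(ℝ, EH) ∞).contMDiffAt

theorem tderiv_cartan_one (x : EH) : tderiv EH EH (cartan σ) 1 x = invDiff EH σ x - x := by
  have hinv : SmoothAt EH EH (fun y : H => y⁻¹) 1 := (contMDiff_inv 𝓘(ℝ, EH) ∞).contMDiffAt
  have h1 := tderiv_mul (E := EH) (u := fun y : H => σ y) (v := fun y : H => y⁻¹) (m := 1)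
    (E'' := EH) (hσ.tdiff 1) hinv.tdiff x
  simp only [inv_one, mul_one, map_one, one_mul] at h1
  rw [sub_eq_add_neg, ← tderiv_inv_one (H := H)]
  refine h1.trans ?_
  have h2 : ∀ v, tderiv EH EH (fun z : H => z) 1 v = v := DFunLike.congr_fun (tderiv_id (1 : H))
  rw [h2, h2]
  rfl

/-- The formula `c^*θ = -2 Ad_h π`. The twisted product rule `c(h y) = c(h) · h c(y) h⁻¹` moves the
derivative to `1`, where it is `s - 1 = -2 · (1 - s)/2`. -/
theorem mc_tderiv_cartan (h : H) (x : EH) :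
    mc EH (cartan σ h) (tderiv EH EH (cartan σ) h (lmul EH h x)) =
      adE EH h ((-2 : ℝ) • proj (invDiff EH σ) x) := by
  have h1 := tderiv_comp_apply (g := cartan σ) (f := fun y : H => h * y) (x := 1)
    (smoothAt_cartan hσ _).tdiff (smoothAt_mul_left h 1).tdiff x
  have e : (fun y : H => cartan σ (h * y)) =
      fun y => cartan σ h * (h * cartan σ y * h⁻¹) := by
    funext y; simp [cartan, mul_assoc]
  rw [e] at h1
  have h2 := tderiv_comp_apply (g := fun z : H => cartan σ h * z)
    (f := fun y : H => h * cartan σ y * h⁻¹) (x := 1)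
    (smoothAt_mul_left _ _).tdiff ((smoothAt_conj h _).tdiff.comp 1 (smoothAt_cartan hσ 1).tdiff) x
  have h3 := tderiv_comp_apply (g := fun z : H => h * z * h⁻¹) (f := cartan σ) (x := 1)
    (smoothAt_conj h _).tdiff (smoothAt_cartan hσ 1).tdiff x
  have h4 : cartan σ 1 = 1 := by simp [cartan]
  simp only [h4, mul_one, mul_inv_cancel] at h2 h3
  rw [h3, tderiv_cartan_one hσ] at h2
  have h5 : tderiv EH EH (cartan σ) h (lmul EH h x) =
      lmul EH (cartan σ h) (adE EH h (invDiff EH σ x - x)) := by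
    have := h1.symm.trans h2
    rwa [mul_one] at this
  rw [h5, mc_lmul]
  congr 1
  rw [proj]
  module

omit [LieGroup 𝓘(ℝ, EH) ∞ H] in
theorem cartan_mul (h : H) {g : H} (hg : g ∈ G) : cartan σ (h * g) = cartan σ h := by
  simp [cartan, hσ.subset_fixed g hg, mul_assoc]

omit [LieGroup 𝓘(ℝ, EH) ∞ H] in
theorem cartan_smul {g : H} (hg : g ∈ G) (h : H) : cartan σ (g * h) = g * cartan σ h * g⁻¹ := by
  simp [cartan, hσ.subset_fixed g hg, mul_assoc]

end SymmetricPair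

/-! ### Fundamental vector fields and evaluation of forms -/

section Fundamental
variable {EG : Type*} [NormedAddCommGroup EG] [NormedSpace ℝ EG]
  {G : Type*} [TopologicalSpace G] [ChartedSpace EG G] [Group G]
  {E : Type*} [NormedAddCommGroup E] [NormedSpace ℝ E]
  {M : Type*} [TopologicalSpace M] [ChartedSpace E M] [MulAction G M]

variable (G E) in
/-- The fundamental vector fields, on the model spaces. -/
def fund (x : M) : EG →L[ℝ] E := tderiv EG E (fun g : G => g • x) 1

end Fundamental

section FormAt
variable {E : Type*} [NormedAddCommGroup E] [NormedSpace ℝ E]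
  {M : Type*} [TopologicalSpace M] [ChartedSpace E M] {k : ℕ}

theorem formAt_add (α β : DiffForm E M k) (x : M) (v : Fin k → E) :
    formAt (α + β) x v = formAt α x v + formAt β x v := rfl

theorem formAt_smul (c : ℝ) (α : DiffForm E M k) (x : M) (v : Fin k → E) :
    formAt (c • α) x v = c * formAt α x v := rfl

end FormAt

/-! ### The quotient H/G and the Cartan map on it -/

section Quotient
variable {EH : Type*} [NormedAddCommGroup EH] [NormedSpace ℝ EH]
  {EG : Type*} [NormedAddCommGroup EG] [NormedSpace ℝ EG]
  {EP : Type*} [NormedAddCommGroup EP] [NormedSpace ℝ EP]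
  {H : Type*} [TopologicalSpace H] [ChartedSpace EH H] [Group H]
  {G : Subgroup H} [ChartedSpace EG G] [ChartedSpace EP (H ⧸ G)]
  {σ : H →* H}

variable (EH EP G) in
/-- The differential at `h` of the quotient map, in the left trivialization. -/
def quotDiff (h : H) : EH →L[ℝ] EP :=
  (tderiv EH EP (QuotientGroup.mk : H → H ⧸ G) h).comp (lmul EH h)

variable (G σ) in
/-- The map `H/G → H` induced by the Cartan map. -/
def cartanQuot (p : H ⧸ G) : H := cartan σ p.out

omit [ChartedSpace EG G] [ChartedSpace EP (H ⧸ G)] in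
theorem cartanQuot_mk (hσ : IsSymmetricPair EH σ G) (h : H) :
    cartanQuot G σ (QuotientGroup.mk h) = cartan σ h := by
  obtain ⟨g, hg⟩ := QuotientGroup.mk_out_eq_mul G h
  rw [cartanQuot, hg, cartan_mul hσ h g.2]

omit [ChartedSpace EG G] [ChartedSpace EP (H ⧸ G)] in
theorem cartanQuot_smul (hσ : IsSymmetricPair EH σ G) (g : G) (p : H ⧸ G) :
    cartanQuot G σ (g • p) = g * cartanQuot G σ p * (g : H)⁻¹ := by
  induction p using QuotientGroup.induction_on with
  | H h =>
    have : g • (QuotientGroup.mk h : H ⧸ G) = QuotientGroup.mk ((g : H) * h) := rfl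
    rw [this, cartanQuot_mk hσ, cartanQuot_mk hσ, cartan_smul hσ g.2]

variable [LieGroup 𝓘(ℝ, EH) ∞ H] [LieGroup 𝓘(ℝ, EG) ∞ G] [IsManifold 𝓘(ℝ, EP) ∞ (H ⧸ G)]
  (hG : Manifold.IsSmoothEmbedding 𝓘(ℝ, EG) 𝓘(ℝ, EH) ∞ (Subtype.val : G → H))
  (hP : Manifold.IsSubmersion 𝓘(ℝ, EH) 𝓘(ℝ, EP) ∞ (QuotientGroup.mk : H → H ⧸ G))
  (hσ : IsSymmetricPair EH σ G)

include hP

omit [LieGroup 𝓘(ℝ, EG) ∞ G] [ChartedSpace EG G] in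
theorem exists_quotDiff_eq (h : H) (v : EP) : ∃ x, quotDiff EH EP G h x = v := by
  obtain ⟨u, hu⟩ := tderiv_surjective hP h v
  exact ⟨mc EH h u, by rw [quotDiff, ContinuousLinearMap.comp_apply, lmul_mc, hu]⟩

omit [LieGroup 𝓘(ℝ, EG) ∞ G] [ChartedSpace EG G] [IsManifold 𝓘(ℝ, EP) ∞ (H ⧸ G)] in
theorem quotDiff_eq (h : H) (x : EH) : quotDiff EH EP G h x =
    tderiv EH EP (fun y : H => (QuotientGroup.mk (h * y) : H ⧸ G)) 1 x := by
  have := tderiv_comp_apply (g := (QuotientGroup.mk : H → H ⧸ G)) (f := fun y : H => h * y)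
    (x := 1) (smoothAt_of_isSubmersion hP _).tdiff (smoothAt_mul_left h 1).tdiff x
  rw [mul_one] at this
  exact this.symm

include hG in
omit [LieGroup 𝓘(ℝ, EG) ∞ G] [IsManifold 𝓘(ℝ, EP) ∞ (H ⧸ G)] in
theorem quotDiff_inc (h : H) (ξ : EG) : quotDiff EH EP G h (inc EH EG G ξ) = 0 := by
  have h1 := tderiv_comp_apply (g := fun y : H => (QuotientGroup.mk (h * y) : H ⧸ G))
    (f := (Subtype.val : G → H)) (x := 1)
    ((smoothAt_of_isSubmersion hP _).tdiff.comp _ (smoothAt_mul_left h _).tdiff)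
    (smoothAt_val hG 1).tdiff ξ
  have e : (fun y : G => (QuotientGroup.mk (h * (y : H)) : H ⧸ G)) = fun _ => QuotientGroup.mk h :=
    funext fun y => (QuotientGroup.mk_mul_of_mem h y.2)
  rw [e, tderiv_const] at h1
  rw [quotDiff_eq hP]
  exact h1.symm

include hG hσ in
omit [IsManifold 𝓘(ℝ, EP) ∞ (H ⧸ G)] in
theorem quotDiff_eq_zero [FiniteDimensional ℝ EH] [FiniteDimensional ℝ EG] (h : H) {x : EH}
    (hx : invDiff EH σ x = x) : quotDiff EH EP G h x = 0 := by
  obtain ⟨ξ, rfl⟩ := exists_inc_eq hG hσ hx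
  exact quotDiff_inc hG hP h ξ

include hG in
omit [LieGroup 𝓘(ℝ, EG) ∞ G] [IsManifold 𝓘(ℝ, EP) ∞ (H ⧸ G)] in
-- In the left trivialization at `h`, right translation by `h` turns `ξ` into `Ad_{h⁻¹} ξ`. Every
-- computation on `P` therefore becomes one with the vectors `Ad_{h⁻¹} ξ` in `𝔥`.
theorem fund_mk (h : H) (ξ : EG) :
    fund G EP (QuotientGroup.mk h : H ⧸ G) ξ =
      quotDiff EH EP G h (adE EH h⁻¹ (inc EH EG G ξ)) := by
  have h1 := tderiv_comp_apply (g := fun y : H => (QuotientGroup.mk (y * h) : H ⧸ G))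
    (f := (Subtype.val : G → H)) (x := 1)
    ((smoothAt_of_isSubmersion hP _).tdiff.comp _ (smoothAt_mul_right h _).tdiff)
    (smoothAt_val hG 1).tdiff ξ
  have h2 := tderiv_comp_apply (g := (QuotientGroup.mk : H → H ⧸ G)) (f := fun y : H => y * h)
    (x := 1) (smoothAt_of_isSubmersion hP _).tdiff (smoothAt_mul_right h 1).tdiff
    (inc EH EG G ξ)
  rw [tderiv_mul_right, one_mul] at h2
  exact h1.trans h2

include hσ in
omit [LieGroup 𝓘(ℝ, EG) ∞ G] [ChartedSpace EG G] in
-- `cartanQuot` is defined through arbitrary coset representatives, but its composition with the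
-- submersion `H → H/G` is the smooth map `cartan σ`.
theorem smoothAt_cartanQuot (p : H ⧸ G) : SmoothAt EP EH (cartanQuot G σ) p := by
  obtain ⟨h, rfl⟩ := QuotientGroup.mk_surjective p
  refine smoothAt_of_comp_isSubmersion hP ?_
  have : (fun y : H => cartanQuot G σ (QuotientGroup.mk y)) = cartan σ :=
    funext (cartanQuot_mk hσ)
  rw [this]
  exact smoothAt_cartan hσ h

include hσ in
omit [LieGroup 𝓘(ℝ, EG) ∞ G] [ChartedSpace EG G] in
theorem tderiv_cartanQuot (h : H) (x : EH) :
    tderiv EP EH (cartanQuot G σ) (QuotientGroup.mk h) (quotDiff EH EP G h x) =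
      lmul EH (cartan σ h) (adE EH h ((-2 : ℝ) • proj (invDiff EH σ) x)) := by
  have h1 := tderiv_comp_apply (g := cartanQuot G σ) (f := (QuotientGroup.mk : H → H ⧸ G))
    (x := h) (smoothAt_cartanQuot hP hσ _).tdiff (smoothAt_of_isSubmersion hP _).tdiff
    (lmul EH h x)
  have e : (fun y : H => cartanQuot G σ (QuotientGroup.mk y)) = cartan σ :=
    funext (cartanQuot_mk hσ)
  rw [e] at h1
  rw [← mc_tderiv_cartan hσ, lmul_mc]
  exact h1.symm

end Quotient

/-! ### The induced forms on H/G, their existence and uniqueness -/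

section Induced
variable {EH : Type*} [NormedAddCommGroup EH] [NormedSpace ℝ EH] [FiniteDimensional ℝ EH]
  {EG : Type*} [NormedAddCommGroup EG] [NormedSpace ℝ EG]
  {EP : Type*} [NormedAddCommGroup EP] [NormedSpace ℝ EP]
  {H : Type*} [TopologicalSpace H] [ChartedSpace EH H] [Group H] [LieGroup 𝓘(ℝ, EH) ∞ H]
  {G : Subgroup H} [ChartedSpace EG G] [ChartedSpace EP (H ⧸ G)]
  {σ : H →* H} {Λ : EH →ₗ[ℝ] EH →ₗ[ℝ] ℝ} {s : EH →L[ℝ] EH}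

variable (H Λ) in
/-- The trilinear form `(x, y, z) ↦ -¼ Λ(x, [y, z])`. -/
def cubicMap : EH →L[ℝ] EH →L[ℝ] EH →L[ℝ] ℝ :=
  ((ContinuousLinearMap.compL ℝ EH (EH →L[ℝ] EH) (EH →L[ℝ] ℝ)).flip (bilinCLM (lieBL H))).comp
    ((ContinuousLinearMap.compL ℝ EH EH ℝ).comp (bilinCLM ((-(1 / 4) : ℝ) • Λ)))

theorem cubicMap_apply (x y z : EH) : cubicMap H Λ x y z = -(1 / 4) * Λ x (lieB H y z) := rfl

/-- The three-form `(x, y, z) ↦ -¼ Λ(x, [y, z])`. -/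
def cubicForm (D : LegendrianData H s Λ) : EH [⋀^Fin 3]→L[ℝ] ℝ :=
  altThree (cubicMap H Λ)
    (fun x y => by rw [cubicMap_apply, D.lie_right_self, mul_zero])
    (fun x y => by rw [cubicMap_apply, lieB_self, map_zero, mul_zero])

theorem cubicForm_apply (D : LegendrianData H s Λ) (v : Fin 3 → EH) :
    cubicForm D v = -(1 / 4) * Λ (v 0) (lieB H (v 1) (v 2)) := rfl

variable (Λ) in
/-- The one-form `-½ Λ(x, ·)`. -/
def linForm (x : EH) : EH [⋀^Fin 1]→L[ℝ] ℝ := altOne ((-(1 / 2) : ℝ) • bilinCLM Λ x)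

omit H in
theorem linForm_apply (x : EH) (v : Fin 1 → EH) : linForm Λ x v = -(1 / 2) * Λ x (v 0) := by
  simp [linForm]

variable (EP G σ) in
/-- The three-form on `H/G` induced by a Legendrian structure. -/
def inducedThree (D : LegendrianData H s Λ) : DiffForm EP (H ⧸ G) 3 :=
  pullback (cartanQuot G σ) (leftForm H (cubicForm D))

variable (EG EP G σ Λ) in
/-- The one-forms on `H/G` induced by a Legendrian structure. -/
def inducedOne : GroupLieAlgebra 𝓘(ℝ, EG) G →ₗ[ℝ] DiffForm EP (H ⧸ G) 1 where
  toFun ξ := pullback (cartanQuot G σ) (leftForm H (linForm Λ (inc EH EG G ξ)))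
  map_add' ξ η := by
    refine formAt_ext fun p => ?_
    ext v
    simp only [formAt_add, formAt_pullback_apply, formAt_leftForm,
      ContinuousAlternatingMap.compContinuousLinearMap_apply, linForm_apply]
    have : inc EH EG G (ξ + η) = inc EH EG G ξ + inc EH EG G η := map_add _ _ _
    rw [this, map_add, LinearMap.add_apply, mul_add]
  map_smul' c ξ := by
    refine formAt_ext fun p => ?_
    ext v
    simp only [RingHom.id_apply, formAt_smul, formAt_pullback_apply, formAt_leftForm,
      ContinuousAlternatingMap.compContinuousLinearMap_apply, linForm_apply]
    have : inc EH EG G (c • ξ) = c • inc EH EG G ξ := map_smul _ _ _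
    rw [this, map_smul, LinearMap.smul_apply, smul_eq_mul]
    ring

variable [IsManifold 𝓘(ℝ, EP) ∞ (H ⧸ G)]
  (hP : Manifold.IsSubmersion 𝓘(ℝ, EH) 𝓘(ℝ, EP) ∞ (QuotientGroup.mk : H → H ⧸ G))
  (hσ : IsSymmetricPair EH σ G) (D : LegendrianData H (invDiff EH σ) Λ)

include hP hσ

/-- Each argument contributes `-2 Ad_h` of its `𝔭`-part; invariance of `Λ` removes `Ad_h`, and `-¼ ·
(-2)³ = 2`. -/
theorem formAt_inducedThree (h : H) (x y z : EH) :
    formAt (inducedThree EP G σ D) (QuotientGroup.mk h)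
      ![quotDiff EH EP G h x, quotDiff EH EP G h y, quotDiff EH EP G h z] =
      2 * Λ (proj (invDiff EH σ) x)
        (lieB H (proj (invDiff EH σ) y) (proj (invDiff EH σ) z)) := by
  rw [inducedThree, formAt_pullback_apply, formAt_leftForm,
    ContinuousAlternatingMap.compContinuousLinearMap_apply, cubicForm_apply]
  simp only [Function.comp_apply, Matrix.cons_val]
  rw [tderiv_cartanQuot hP hσ, tderiv_cartanQuot hP hσ, tderiv_cartanQuot hP hσ,
    cartanQuot_mk hσ, mc_lmul, mc_lmul, mc_lmul, ← adE_lieB, D.Ad_invariant, adE_inv_adE]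
  simp only [← lieBL_apply, map_smul, LinearMap.smul_apply, smul_eq_mul]
  ring

theorem formAt_inducedOne (ξ : EG) (h : H) (x : EH) :
    formAt (inducedOne EG EP G σ Λ ξ) (QuotientGroup.mk h) ![quotDiff EH EP G h x] =
      Λ (inc EH EG G ξ) (adE EH h (proj (invDiff EH σ) x)) := by
  change formAt (pullback (cartanQuot G σ) (leftForm H (linForm Λ (inc EH EG G ξ)))) _ _ = _
  rw [formAt_pullback_apply, formAt_leftForm,
    ContinuousAlternatingMap.compContinuousLinearMap_apply, linForm_apply]
  simp only [Function.comp_apply, Matrix.cons_val]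
  rw [tderiv_cartanQuot hP hσ, cartanQuot_mk hσ, mc_lmul]
  simp only [map_smul, smul_eq_mul]
  ring

/-- The derivative is taken on `H`, by naturality and the Maurer-Cartan equation; the constant is
`-(-½) · (-2)² = 2`. -/
theorem formAt_extD_inducedOne (ξ : EG) (h : H) (x y : EH) :
    formAt (extD (inducedOne EG EP G σ Λ ξ)) (QuotientGroup.mk h)
      ![quotDiff EH EP G h x, quotDiff EH EP G h y] =
      2 * Λ (inc EH EG G ξ)
        (adE EH h (lieB H (proj (invDiff EH σ) x) (proj (invDiff EH σ) y))) := by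
  have h1 := formAt_extD_pullback (x := (QuotientGroup.mk h : H ⧸ G))
    (smoothFormAt_leftForm (H := H) (linForm Λ (inc EH EG G ξ)) (cartanQuot G σ _))
    (smoothAt_cartanQuot hP hσ _)
  refine (DFunLike.congr_fun h1 _).trans ?_
  rw [formAt_pullback_apply]
  have e : (fun i => tderiv EP EH (cartanQuot G σ) (QuotientGroup.mk h)
      ((![quotDiff EH EP G h x, quotDiff EH EP G h y] : Fin 2 → EP) i)) =
      ![lmul EH (cartanQuot G σ (QuotientGroup.mk h)) (adE EH h ((-2 : ℝ) • proj (invDiff EH σ) x)),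
        lmul EH (cartanQuot G σ (QuotientGroup.mk h))
          (adE EH h ((-2 : ℝ) • proj (invDiff EH σ) y))] := by
    funext i
    rw [cartanQuot_mk hσ]
    fin_cases i
    · exact tderiv_cartanQuot hP hσ h x
    · exact tderiv_cartanQuot hP hσ h y
  refine (congrArg _ e).trans ?_
  rw [formAt_extD_leftForm_one, linForm_apply, ← adE_lieB]
  simp only [← lieBL_apply, map_smul, LinearMap.smul_apply, smul_eq_mul, Matrix.cons_val]
  ring

theorem isInduced_induced :
    IsInduced σ (Λ : LinearMap.BilinForm ℝ (GroupLieAlgebra 𝓘(ℝ, EH) H))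
      (inducedThree EP G σ D) (inducedOne EG EP G σ Λ) where
  pullback_Ξ h u v w := by
    obtain ⟨x, rfl⟩ : ∃ x : EH, lmul EH h x = u := ⟨mc EH h u, lmul_mc (E := EH) h u⟩
    obtain ⟨y, rfl⟩ : ∃ x : EH, lmul EH h x = v := ⟨mc EH h v, lmul_mc (E := EH) h v⟩
    obtain ⟨z, rfl⟩ : ∃ x : EH, lmul EH h x = w := ⟨mc EH h w, lmul_mc (E := EH) h w⟩
    have hp : ∀ x : EH, piForm σ h (lmul EH h x) = proj (invDiff EH σ) x := fun x => by
      change proj (invDiff EH σ) (mc EH h (lmul EH h x)) = _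
      rw [mc_lmul]
    have hb : ∀ x y : EH, bracketPi σ h (lmul EH h x) (lmul EH h y) =
        lieB H (proj (invDiff EH σ) x) (proj (invDiff EH σ) y) -
          lieB H (proj (invDiff EH σ) y) (proj (invDiff EH σ) x) := fun x y => by
      have h0 : bracketPi σ h (lmul EH h x) (lmul EH h y) =
        lieB (E := EH) H (piForm σ h (lmul EH h x)) (piForm σ h (lmul EH h y)) -
          lieB (E := EH) H (piForm σ h (lmul EH h y)) (piForm σ h (lmul EH h x)) := rfl
      refine h0.trans ?_
      rw [hp, hp]
    have e : (fun i => tderiv EH EP (QuotientGroup.mk : H → H ⧸ G) h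
        ((![lmul EH h x, lmul EH h y, lmul EH h z] : Fin 3 → EH) i)) =
        ![quotDiff EH EP G h x, quotDiff EH EP G h y, quotDiff EH EP G h z] := by
      funext i; fin_cases i <;> rfl
    have h1 := formAt_pullback_apply (E' := EP) (QuotientGroup.mk : H → H ⧸ G)
      (inducedThree EP G σ D) h ![lmul EH h x, lmul EH h y, lmul EH h z]
    rw [e, formAt_inducedThree hP hσ] at h1
    refine h1.trans ?_
    have h2 : upsilonForm σ (Λ : LinearMap.BilinForm ℝ (GroupLieAlgebra 𝓘(ℝ, EH) H)) h
        (lmul EH h x) (lmul EH h y) (lmul EH h z) = (1 / 3 : ℝ) *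
        (Λ (piForm σ h (lmul EH h x)) (bracketPi σ h (lmul EH h y) (lmul EH h z)) +
        Λ (piForm σ h (lmul EH h y)) (bracketPi σ h (lmul EH h z) (lmul EH h x)) +
        Λ (piForm σ h (lmul EH h z)) (bracketPi σ h (lmul EH h x) (lmul EH h y))) := rfl
    refine Eq.trans ?_ h2.symm
    rw [hb, hb, hb, hp, hp, hp]
    generalize proj (invDiff EH σ) x = a
    generalize proj (invDiff EH σ) y = b
    generalize proj (invDiff EH σ) z = c
    -- By antisymmetry each bracket difference doubles and the three cyclic terms coincide: `⅓ · 3 ·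
    -- 2 = 2`.
    rw [map_sub, map_sub, map_sub, D.lie_right_swap a b c, D.lie_right_swap b c a,
      D.lie_right_swap c a b, D.lie_cyclic c a b, D.lie_cyclic a b c]
    ring
  pullback_τ ξ h u := by
    obtain ⟨x, rfl⟩ : ∃ x : EH, lmul EH h x = u := ⟨mc EH h u, lmul_mc (E := EH) h u⟩
    have hp : piForm σ h (lmul EH h x) = proj (invDiff EH σ) x := by
      change proj (invDiff EH σ) (mc EH h (lmul EH h x)) = _
      rw [mc_lmul]
    have e : (fun i => tderiv EH EP (QuotientGroup.mk : H → H ⧸ G) h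
        ((![lmul EH h x] : Fin 1 → EH) i)) = ![quotDiff EH EP G h x] := by
      funext i; fin_cases i; rfl
    have h1 := formAt_pullback_apply (E' := EP) (QuotientGroup.mk : H → H ⧸ G)
      (inducedOne EG EP G σ Λ ξ) h ![lmul EH h x]
    rw [e] at h1
    refine (h1.trans (formAt_inducedOne (EG := EG) hP hσ ξ h x)).trans ?_
    have h2 : betaForm σ (Λ : LinearMap.BilinForm ℝ (GroupLieAlgebra 𝓘(ℝ, EH) H))
      (lieIncl G ξ) h (lmul EH h x) =
        Λ (inc EH EG G ξ) (adE EH h (piForm σ h (lmul EH h x))) := rfl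
    refine Eq.trans ?_ h2.symm
    rw [hp]

omit hσ [FiniteDimensional ℝ EH] in
/-- The induced forms are unique. -/
theorem IsInduced.unique {Λ : LinearMap.BilinForm ℝ (GroupLieAlgebra 𝓘(ℝ, EH) H)}
    {Ξ Ξ' : DiffForm EP (H ⧸ G) 3}
    {τ τ' : GroupLieAlgebra 𝓘(ℝ, EG) G →ₗ[ℝ] DiffForm EP (H ⧸ G) 1}
    (h : IsInduced σ Λ Ξ τ) (h' : IsInduced σ Λ Ξ' τ') : Ξ = Ξ' ∧ τ = τ' := by
  constructor
  · refine formAt_ext fun p => ?_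
    obtain ⟨a, rfl⟩ := QuotientGroup.mk_surjective p
    refine formAt_eq_of_pullback_eq hP ?_
    ext v
    have e : v = ![v 0, v 1, v 2] := by funext i; fin_cases i <;> rfl
    rw [e]
    exact (h.pullback_Ξ a _ _ _).trans (h'.pullback_Ξ a _ _ _).symm
  · refine LinearMap.ext fun ξ => formAt_ext fun p => ?_
    obtain ⟨a, rfl⟩ := QuotientGroup.mk_surjective p
    refine formAt_eq_of_pullback_eq hP ?_
    ext v
    have e : v = ![v 0] := by funext i; fin_cases i; rfl
    rw [e]
    exact (h.pullback_τ ξ a _).trans (h'.pullback_τ ξ a _).symm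

end Induced

/-! ### Smooth actions and their fundamental fields -/

section SmoothAction
variable {EG : Type*} [NormedAddCommGroup EG] [NormedSpace ℝ EG]
  {G : Type*} [TopologicalSpace G] [ChartedSpace EG G] [Group G]
  {E : Type*} [NormedAddCommGroup E] [NormedSpace ℝ E]
  {M : Type*} [TopologicalSpace M] [ChartedSpace E M] [MulAction G M]
  {EK : Type*} [NormedAddCommGroup EK] [NormedSpace ℝ EK]
  {K : Type*} [TopologicalSpace K] [ChartedSpace EK K] [Group K] [LieGroup 𝓘(ℝ, EK) ∞ K]

/-- An action covered through a submersion by left translations is smooth. -/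
theorem contMDiffSMul_of_isSubmersion [IsManifold 𝓘(ℝ, E) ∞ M] {q : K → M}
    (hq : Manifold.IsSubmersion 𝓘(ℝ, EK) 𝓘(ℝ, E) ∞ q) (hsurj : Function.Surjective q)
    {f : G → K} (hf : ∀ g, SmoothAt EG EK f g) (h : ∀ g k, g • q k = q (f g * k)) :
    ContMDiffSMul 𝓘(ℝ, EG) 𝓘(ℝ, E) ∞ G M where
  contMDiff_smul := by
    rintro ⟨g, x⟩
    obtain ⟨k, rfl⟩ := hsurj x
    obtain ⟨s, hsx, hs, hqs⟩ := exists_smooth_section hq k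
    have h1 : ContMDiffAt (𝓘(ℝ, EG).prod 𝓘(ℝ, E)) 𝓘(ℝ, EK) ∞
        (fun p : G × M => f p.1 * s p.2) (g, q k) :=
      ContMDiffAt.mul (ContMDiffAt.comp (g := f) (g, q k) (hf g) contMDiffAt_fst)
        (ContMDiffAt.comp (g := s) (g, q k) hs contMDiffAt_snd)
    have h2 : ContMDiffAt (𝓘(ℝ, EG).prod 𝓘(ℝ, E)) 𝓘(ℝ, E) ∞
        (fun p : G × M => q (f p.1 * s p.2)) (g, q k) :=
      ContMDiffAt.comp (g := q) (g, q k) (smoothAt_of_isSubmersion hq _) h1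
    refine h2.congr_of_eventuallyEq ?_
    have h3 : Tendsto (Prod.snd : G × M → M) (𝓝 (g, q k)) (𝓝 (q k)) := continuousAt_snd
    filter_upwards [h3.eventually hqs] with p hp
    rw [← h, hp]

variable [hA : ContMDiffSMul 𝓘(ℝ, EG) 𝓘(ℝ, E) ∞ G M]

include hA in
variable (EG E) in
theorem smoothAt_smul (g : G) (x : M) : SmoothAt E E (fun y : M => g • y) x :=
  (ContMDiffSMul.contMDiff_const_smul (I := 𝓘(ℝ, EG)) g).contMDiffAt

theorem smoothAt_orbitMap (x : M) (g : G) : SmoothAt EG E (fun y : G => y • x) g :=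
  ContMDiffAt.smul (f := fun y : G => y) (g := fun _ : G => x) contMDiffAt_id contMDiffAt_const

variable [LieGroup 𝓘(ℝ, EG) ∞ G]

theorem tderiv_orbitMap (x : M) (g : G) (ξ : EG) :
    tderiv EG E (fun y : G => y • x) g (lmul EG g ξ) =
      tderiv E E (fun y : M => g • y) x (fund G E x ξ) := by
  have h1 := tderiv_comp_apply (g := fun y : G => y • x) (f := fun y : G => g * y) (x := 1)
    (smoothAt_orbitMap (E := E) x _).tdiff (smoothAt_mul_left g 1).tdiff ξ
  have h2 := tderiv_comp_apply (g := fun y : M => g • y) (f := fun y : G => y • x) (x := 1)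
    (smoothAt_smul EG E g _).tdiff (smoothAt_orbitMap (E := E) x 1).tdiff ξ
  simp only [mul_one, one_smul, mul_smul] at h1 h2
  exact h1.symm.trans h2

/-- Differentiate `g y x = (g y g⁻¹) g x` at `y = 1`. -/
theorem tderiv_smul_fund (g : G) (x : M) (ξ : EG) :
    tderiv E E (fun y : M => g • y) x (fund G E x ξ) = fund G E (g • x) (adE EG g ξ) := by
  have h1 := tderiv_comp_apply (g := fun y : G => y • (g • x)) (f := fun y : G => g * y * g⁻¹)
    (x := 1) (smoothAt_orbitMap (E := E) _ _).tdiff (smoothAt_conj g 1).tdiff ξ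
  have h2 := tderiv_comp_apply (g := fun y : M => g • y) (f := fun y : G => y • x) (x := 1)
    (smoothAt_smul EG E g _).tdiff (smoothAt_orbitMap (E := E) x 1).tdiff ξ
  simp only [mul_one, mul_inv_cancel, one_smul, mul_smul, inv_smul_smul] at h1 h2
  exact h2.symm.trans h1

end SmoothAction

/-! ### H/G is a premoment space -/

section Premoment
variable {EH : Type*} [NormedAddCommGroup EH] [NormedSpace ℝ EH] [FiniteDimensional ℝ EH]
  {EG : Type*} [NormedAddCommGroup EG] [NormedSpace ℝ EG]
  {EP : Type*} [NormedAddCommGroup EP] [NormedSpace ℝ EP] [FiniteDimensional ℝ EP]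
  {H : Type*} [TopologicalSpace H] [ChartedSpace EH H] [Group H] [LieGroup 𝓘(ℝ, EH) ∞ H]
  {G : Subgroup H} [ChartedSpace EG G] [ChartedSpace EP (H ⧸ G)]
  {σ : H →* H} {Λ : EH →ₗ[ℝ] EH →ₗ[ℝ] ℝ} {s : EH →L[ℝ] EH} {k : ℕ}

omit [FiniteDimensional ℝ EH] in
theorem pullback_conj_leftForm (g : H) (A : EH [⋀^Fin k]→L[ℝ] ℝ) :
    pullback (fun x : H => g * x * g⁻¹) (leftForm H A) =
      leftForm H (A.compContinuousLinearMap (adE EH g)) :=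
  pullback_hom_leftForm (MulAut.conj g).toMonoidHom (fun x => (smoothAt_conj g x).tdiff) A

omit [FiniteDimensional ℝ EH] [LieGroup 𝓘(ℝ, EH) ∞ H] in
theorem LegendrianData.Ad_invariant' (D : LegendrianData H s Λ) (h : H) (x y : EH) :
    Λ x (adE EH h y) = Λ (adE EH h⁻¹ x) y := by
  rw [D.Ad_invariant, inv_inv]

theorem cubicForm_adE (D : LegendrianData H s Λ) (g : H) (v : Fin 3 → EH) :
    cubicForm D (fun i => adE EH g (v i)) = cubicForm D v := by
  rw [cubicForm_apply, cubicForm_apply, ← adE_lieB, D.Ad_invariant, adE_inv_adE]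

variable [LieGroup 𝓘(ℝ, EG) ∞ G] [IsManifold 𝓘(ℝ, EP) ∞ (H ⧸ G)]
  (hG : Manifold.IsSmoothEmbedding 𝓘(ℝ, EG) 𝓘(ℝ, EH) ∞ (Subtype.val : G → H))
  (hP : Manifold.IsSubmersion 𝓘(ℝ, EH) 𝓘(ℝ, EP) ∞ (QuotientGroup.mk : H → H ⧸ G))
  (hσ : IsSymmetricPair EH σ G) (D : LegendrianData H (invDiff EH σ) Λ)

include hG hP in
omit [FiniteDimensional ℝ EH] [FiniteDimensional ℝ EP] [LieGroup 𝓘(ℝ, EG) ∞ G] in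
theorem contMDiffSMul_quotient : ContMDiffSMul 𝓘(ℝ, EG) 𝓘(ℝ, EP) ∞ G (H ⧸ G) :=
  contMDiffSMul_of_isSubmersion hP QuotientGroup.mk_surjective (smoothAt_val hG) fun _ _ => rfl

include hG hP hσ in
omit [FiniteDimensional ℝ EH] [FiniteDimensional ℝ EP] [LieGroup 𝓘(ℝ, EG) ∞ G] in
-- The Cartan map intertwines the action of `g` with conjugation, and conjugation changes a
-- left-invariant form by `Ad_g` on its value at `1`. Invariance of `Ξ` and equivariance of `τ` are
-- both instances.
theorem pullback_smul_cartanQuot (g : G) (A : EH [⋀^Fin k]→L[ℝ] ℝ) :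
    pullback (E := EP) (E' := EP) (fun p : H ⧸ G => g • p)
      (pullback (cartanQuot G σ) (leftForm H A)) =
      pullback (cartanQuot G σ) (leftForm H (A.compContinuousLinearMap (adE EH (g : H)))) := by
  have := contMDiffSMul_quotient hG hP
  refine formAt_ext fun p => ?_
  rw [← formAt_pullback_comp (smoothAt_cartanQuot hP hσ _).tdiff (smoothAt_smul EG EP g p).tdiff,
    ← pullback_conj_leftForm, ← formAt_pullback_comp (smoothAt_conj _ _).tdiff
      (smoothAt_cartanQuot hP hσ _).tdiff]
  simp only [cartanQuot_smul hσ]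

include hP hσ in
omit [LieGroup 𝓘(ℝ, EG) ∞ G] [ChartedSpace EG G] in
theorem isSmoothForm_pullback_cartanQuot (A : EH [⋀^Fin k]→L[ℝ] ℝ) :
    IsSmoothForm (E := EP) (pullback (cartanQuot G σ) (leftForm H A)) :=
  isSmoothForm_iff.2 fun p =>
    (smoothFormAt_leftForm A _).pullback (smoothAt_cartanQuot hP hσ p)

include hG hP hσ D in
omit [FiniteDimensional ℝ EP] in
theorem inducedOne_adE (g : G) (ξ : EG) :
    inducedOne EG EP G σ Λ (adE EG g ξ) =
      pullback (fun p : H ⧸ G => g⁻¹ • p) (inducedOne EG EP G σ Λ ξ) := by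
  refine Eq.trans ?_ (pullback_smul_cartanQuot hG hP hσ g⁻¹ (linForm Λ (inc EH EG G ξ))).symm
  have h2 : (linForm Λ (inc EH EG G ξ)).compContinuousLinearMap (adE EH ((g⁻¹ : G) : H)) =
      linForm Λ (inc EH EG G (adE EG g ξ)) := by
    ext v
    rw [ContinuousAlternatingMap.compContinuousLinearMap_apply, linForm_apply, linForm_apply,
      inc_adE hG, D.Ad_invariant]
    rfl
  rw [h2]
  rfl

include hG hP hσ in
omit [FiniteDimensional ℝ EP] [LieGroup 𝓘(ℝ, EG) ∞ G] in
-- A bracket of two `𝔭`-parts is fixed by `s`, so pairing with it does not distinguish `Ad_{h⁻¹} ξ`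
-- from its `𝔭`-part. After this replacement the two formulas agree.
theorem inducedThree_fund (ξ : EG) (p : H ⧸ G) (u v : EP) :
    formAt (inducedThree EP G σ D) p ![fund G EP p ξ, u, v] =
      formAt (extD (inducedOne EG EP G σ Λ ξ)) p ![u, v] := by
  obtain ⟨h, rfl⟩ := QuotientGroup.mk_surjective p
  obtain ⟨x, rfl⟩ := exists_quotDiff_eq hP h u
  obtain ⟨y, rfl⟩ := exists_quotDiff_eq hP h v
  rw [fund_mk hG hP, formAt_inducedThree hP hσ, formAt_extD_inducedOne hP hσ,
    D.proj_left (D.map_lie_proj _ _), D.Ad_invariant']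

include hG hP hσ in
omit [FiniteDimensional ℝ EP] [LieGroup 𝓘(ℝ, EG) ∞ G] in
theorem formAt_inducedOne_fund (ξ η : EG) (h : H) :
    formAt (inducedOne EG EP G σ Λ ξ) (QuotientGroup.mk h) ![fund G EP (QuotientGroup.mk h : H ⧸ G) η] =
      Λ (inc EH EG G ξ) (adE EH h (proj (invDiff EH σ) (adE EH h⁻¹ (inc EH EG G η)))) := by
  rw [fund_mk hG hP, formAt_inducedOne hP hσ]

include hG hP hσ D in
omit [FiniteDimensional ℝ EP] [LieGroup 𝓘(ℝ, EG) ∞ G] in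
theorem inducedOne_fund_self (ξ : EG) (p : H ⧸ G) :
    formAt (inducedOne EG EP G σ Λ ξ) p ![fund G EP p ξ] = 0 := by
  obtain ⟨h, rfl⟩ := QuotientGroup.mk_surjective p
  rw [formAt_inducedOne_fund hG hP hσ, D.Ad_invariant', D.apply_proj_self]
  have h2 := invDiff_inc hG hσ ξ
  rw [D.Ad_invariant, inv_inv, adE_adE_inv, D.isotropic h2 h2]

include hG hP hσ in
theorem isPremomentSpace_induced :
    IsPremomentSpace (inducedThree EP G σ D) (inducedOne EG EP G σ Λ) where
  isManifold := inferInstance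
  smooth_action := contMDiffSMul_quotient hG hP
  smooth_Ξ := isSmoothForm_pullback_cartanQuot hP hσ _
  smooth_τ ξ := isSmoothForm_pullback_cartanQuot hP hσ _
  invariant g := by
    rw [inducedThree, pullback_smul_cartanQuot hG hP hσ]
    congr 2
    ext v
    exact cubicForm_adE D g v
  equivariant g ξ := inducedOne_adE hG hP hσ D g ξ
  closed₁ := by
    refine formAt_ext fun p => ?_
    rw [inducedThree, formAt_extD_pullback (smoothFormAt_leftForm _ _)
      (smoothAt_cartanQuot hP hσ p), extD_leftForm_eq_zero (by decide) _ (cubicForm_adE D)]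
    ext v
    rfl
  closed₂ ξ p u v := inducedThree_fund hG hP hσ D ξ p u v
  closed₃ ξ p := inducedOne_fund_self hG hP hσ D ξ p

end Premoment

/-! ### Orbits and their two-forms, for a general equivariant form -/

section Orbit
variable {EG : Type*} [NormedAddCommGroup EG] [NormedSpace ℝ EG]
  {G : Type*} [TopologicalSpace G] [ChartedSpace EG G] [Group G]
  {EP : Type*} [NormedAddCommGroup EP] [NormedSpace ℝ EP]
  {P : Type*} [TopologicalSpace P] [ChartedSpace EP P] [MulAction G P]
  {E : Type*} [NormedAddCommGroup E] [NormedSpace ℝ E]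

/-- The bilinear form `(ξ, η) ↦ τ(ξ)_x(η_P(x))`. -/
def tauForm (τ : EG →ₗ[ℝ] DiffForm EP P 1) (x : P) : EG →ₗ[ℝ] EG →ₗ[ℝ] ℝ :=
  LinearMap.mk₂ ℝ (fun ξ η => formAt (τ ξ) x ![fund G EP x η])
    (fun ξ ξ' η => by rw [map_add, formAt_add])
    (fun c ξ η => by rw [map_smul, formAt_smul, smul_eq_mul])
    (fun ξ η η' => by rw [map_add]; exact (formAt (τ ξ) x).vecCons_add _ _ _)
    (fun c ξ η => by rw [map_smul]; exact (formAt (τ ξ) x).vecCons_smul _ _ _)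

theorem tauForm_apply (τ : EG →ₗ[ℝ] DiffForm EP P 1) (x : P) (ξ η : EG) :
    tauForm (G := G) τ x ξ η = formAt (τ ξ) x ![fund G EP x η] := rfl

section Pairing
variable {τ : EG →ₗ[ℝ] DiffForm EP P 1}

theorem tauForm_skew (h₃ : ∀ ξ x, tauForm (G := G) τ x ξ ξ = 0) (x : P) (ξ η : EG) :
    tauForm (G := G) τ x ξ η = -tauForm (G := G) τ x η ξ := by
  have h := h₃ (ξ + η) x
  simp only [map_add, LinearMap.add_apply, h₃] at h
  linarith

/-- Equivariance of `τ` combined with that of fundamental fields; this is what makes the orbit form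
invariant. -/
theorem tauForm_adE [LieGroup 𝓘(ℝ, EG) ∞ G] [ContMDiffSMul 𝓘(ℝ, EG) 𝓘(ℝ, EP) ∞ G P]
    (hτ : ∀ (g : G) ξ, τ (adE EG g ξ) = pullback (fun x : P => g⁻¹ • x) (τ ξ)) (g : G) (x : P)
    (ξ η : EG) :
    tauForm (G := G) τ (g • x) (adE EG g ξ) (adE EG g η) = tauForm (G := G) τ x ξ η := by
  have h1 := formAt_pullback_comp (x := x) (smoothAt_smul EG EP g⁻¹ (g • x)).tdiff
    (smoothAt_smul EG EP g x).tdiff (τ ξ)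
  simp only [inv_smul_smul] at h1
  rw [formAt_pullback_id, ← hτ] at h1
  rw [tauForm_apply, tauForm_apply, ← tderiv_smul_fund, h1, formAt_pullback_apply]
  congr 1
  funext i
  fin_cases i
  rfl

end Pairing

variable {p : P} [TopologicalSpace (MulAction.orbit G p)] [ChartedSpace E (MulAction.orbit G p)]

variable (G p) in
/-- The orbit map `G → G • p`. -/
abbrev orbitMap (g : G) : MulAction.orbit G p := ⟨g • p, MulAction.mem_orbit p g⟩

omit [TopologicalSpace G] [TopologicalSpace (MulAction.orbit G p)] [TopologicalSpace P] in
theorem orbitMap_surjective : Function.Surjective (orbitMap G p) := by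
  rintro ⟨_, g, rfl⟩
  exact ⟨g, rfl⟩

omit [TopologicalSpace G] [TopologicalSpace (MulAction.orbit G p)] [TopologicalSpace P] in
theorem orbitMap_eq : orbitMap G p = fun g => g • orbitMap G p 1 :=
  funext fun g => Subtype.ext (by simp [MulAction.orbit.coe_smul])

variable [LieGroup 𝓘(ℝ, EG) ∞ G]
  [ContMDiffSMul 𝓘(ℝ, EG) 𝓘(ℝ, EP) ∞ G P] [IsManifold 𝓘(ℝ, E) ∞ (MulAction.orbit G p)]
  (hO : Manifold.IsSubmersion 𝓘(ℝ, EG) 𝓘(ℝ, E) ∞ (orbitMap G p))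

include hO

omit [TopologicalSpace P] in
theorem contMDiffSMul_orbit : ContMDiffSMul 𝓘(ℝ, EG) 𝓘(ℝ, E) ∞ G (MulAction.orbit G p) :=
  contMDiffSMul_of_isSubmersion (f := fun g : G => g) hO orbitMap_surjective
    (fun _ => contMDiffAt_id) fun g k => Subtype.ext (by simp [MulAction.orbit.coe_smul, mul_smul])

theorem smoothAt_orbit_val (x : MulAction.orbit G p) :
    SmoothAt E EP (Subtype.val : MulAction.orbit G p → P) x := by
  obtain ⟨g, rfl⟩ := orbitMap_surjective x
  exact smoothAt_of_comp_isSubmersion hO (smoothAt_orbitMap (EG := EG) (E := EP) p g)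

omit [TopologicalSpace P] in
theorem exists_fund_eq (x : MulAction.orbit G p) (v : E) :
    ∃ ξ : EG, fund G E x ξ = v := by
  have := contMDiffSMul_orbit hO
  obtain ⟨g, rfl⟩ := orbitMap_surjective x
  obtain ⟨w, rfl⟩ := tderiv_surjective hO g v
  refine ⟨adE EG g (mc EG g w), ?_⟩
  have h := tderiv_orbitMap (E := E) (orbitMap G p 1) g (mc EG g w)
  rw [lmul_mc, ← orbitMap_eq, tderiv_smul_fund] at h
  rw [h, congrFun orbitMap_eq g]

theorem tderiv_val_fund (x : MulAction.orbit G p) (ξ : EG) :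
    tderiv E EP (Subtype.val : MulAction.orbit G p → P) x (fund G E x ξ) =
      fund G EP (x : P) ξ := by
  have := contMDiffSMul_orbit hO
  have h := tderiv_comp_apply (g := (Subtype.val : MulAction.orbit G p → P))
    (f := fun g : G => g • x) (x := 1) (smoothAt_orbit_val (EP := EP) hO _).tdiff
    (smoothAt_orbitMap (EG := EG) (E := E) x 1).tdiff ξ
  rw [one_smul] at h
  exact h.symm

/-- A fundamental vector field of the orbit vanishes where that of the ambient space does. -/
theorem fund_orbit_eq_zero [FiniteDimensional ℝ EG] [IsManifold 𝓘(ℝ, EP) ∞ P]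
    (x : MulAction.orbit G p) {ξ : EG}
    (hξ : fund G EP (x : P) ξ = 0) : fund G E x ξ = 0 := by
  have := contMDiffSMul_orbit hO
  -- Injectivity of the differential of the inclusion is not available here. Instead, `t ↦ γ t • x`
  -- is constant in the ambient space, hence constant in the orbit because the inclusion is
  -- injective.
  obtain ⟨γ, hγ⟩ := exists_isLeftCurve G ξ
  refine hγ.tderiv_eq_zero (m := x) (smoothAt_orbitMap (EG := EG) (E := E) x 1).tdiff ?_
  have h := hγ.eventually_eq (f := fun g : G => g • (x : P)) (E' := EP)
    (fun g => (smoothAt_orbitMap (EG := EG) (E := EP) (x : P) g).tdiff)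
    (fun g => by rw [tderiv_orbitMap, hξ, map_zero])
  filter_upwards [h] with t ht
  rw [one_smul] at ht
  exact Subtype.ext ht

/-! ### The two-form of an orbit -/

variable {τ : EG →ₗ[ℝ] DiffForm EP P 1}

omit [LieGroup 𝓘(ℝ, EG) ∞ G]
  [ContMDiffSMul 𝓘(ℝ, EG) 𝓘(ℝ, EP) ∞ G P] [IsManifold 𝓘(ℝ, E) ∞ (MulAction.orbit G p)] hO
  [TopologicalSpace P] in
variable (EG G E p) in
theorem exists_orbitSection (hs : ∀ (x : MulAction.orbit G p) (v : E),
    ∃ ξ : EG, fund G E x ξ = v) (x : MulAction.orbit G p) : ∃ R : E →ₗ[ℝ] EG, ∀ v, fund G E x (R v) = v := by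
  obtain ⟨R, hR⟩ := (fund G E x).toLinearMap.exists_rightInverse_of_surjective
    (LinearMap.range_eq_top.2 (hs x))
  exact ⟨R, fun v => LinearMap.congr_fun hR v⟩

/-- Fundamental vectors span the tangent space of the orbit, so a linear section of `ξ ↦ ξ_O(x)`
transports the bilinear form. The result is independent of the section: the second argument of
`tauForm` enters only through the vector it generates, and skewness gives the same for the first. -/
theorem exists_orbitForm [FiniteDimensional ℝ E] (h₃ : ∀ ξ x, tauForm (G := G) τ x ξ ξ = 0) :
    ∃ α : DiffForm E (MulAction.orbit G p) 2, ∀ x (ξ η : EG),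
      formAt α x ![fund G E x ξ, fund G E x η] = tauForm (G := G) τ (x : P) ξ η := by
  choose R hR using exists_orbitSection EG G E p (exists_fund_eq hO)
  refine ⟨fun x => altTwo (E := E) (bilinCLM ((tauForm (G := G) τ (x : P)).compl₁₂ (R x) (R x)))
    (fun v => h₃ _ _), fun x ξ η => ?_⟩
  have hz : ∀ ζ ζ', fund G E x ζ = 0 → tauForm (G := G) τ (x : P) ζ' ζ = 0 := fun ζ ζ' h => by
    rw [tauForm_apply, ← tderiv_val_fund hO, h, map_zero]
    exact (formAt (τ ζ') (x : P)).map_coord_zero 0 rfl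
  have hd : ∀ ζ, fund G E x (R x (fund G E x ζ) - ζ) = 0 := fun ζ => by
    rw [map_sub, hR, sub_self]
  have h1 := hz _ (R x (fund G E x ξ)) (hd η)
  have h2 := hz _ η (hd ξ)
  rw [tauForm_skew h₃] at h2
  simp only [map_sub, LinearMap.sub_apply] at h1 h2
  change tauForm (G := G) τ (x : P) (R x (fund G E x ξ)) (R x (fund G E x η)) = _
  linarith

omit [TopologicalSpace P] in
theorem orbit_formAt_ext {α β : DiffForm E (MulAction.orbit G p) 2}
    (h : ∀ x (ξ η : EG), formAt α x ![fund G E x ξ, fund G E x η] =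
      formAt β x ![fund G E x ξ, fund G E x η]) : α = β := by
  refine formAt_ext fun x => ?_
  ext v
  obtain ⟨ξ, hξ⟩ := exists_fund_eq hO x (v 0)
  obtain ⟨η, hη⟩ := exists_fund_eq hO x (v 1)
  have e : v = ![fund G E x ξ, fund G E x η] := by
    rw [hξ, hη]; funext i; fin_cases i <;> rfl
  rw [e, h]

section
variable {α : DiffForm E (MulAction.orbit G p) 2}
  (hα : ∀ x ξ η, formAt α x ![fund G E x ξ, fund G E x η] = tauForm (G := G) τ (x : P) ξ η)
  (hτ : ∀ (g : G) ξ, τ (adE EG g ξ) = pullback (fun x : P => g⁻¹ • x) (τ ξ))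
include hα hτ

theorem pullback_smul_orbitForm (g : G) :
    pullback (fun x : MulAction.orbit G p => g • x) α = α := by
  have := contMDiffSMul_orbit hO
  refine orbit_formAt_ext hO fun x ξ η => ?_
  rw [formAt_pullback_apply, hα, ← tauForm_adE hτ g]
  have h1 := hα (g • x) (adE EG g ξ) (adE EG g η)
  refine Eq.trans ?_ h1
  congr 1
  funext i
  fin_cases i
  · exact tderiv_smul_fund (E := E) g x ξ
  · exact tderiv_smul_fund (E := E) g x η

/-- The map `g ↦ g • x` intertwines left translations with the action, so invariance of `α` becomes
left invariance on `G`. -/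
theorem pullback_orbitForm (x : MulAction.orbit G p) :
    ∃ A : EG [⋀^Fin 2]→L[ℝ] ℝ, pullback (fun g : G => g • x) α = leftForm G A ∧
      ∀ ξ η, A ![ξ, η] = tauForm (G := G) τ (x : P) ξ η := by
  have := contMDiffSMul_orbit hO
  refine ⟨_, eq_leftForm fun a => ?_, fun ξ η => ?_⟩
  · rw [← formAt_pullback_comp (smoothAt_orbitMap (E := E) x _).tdiff (smoothAt_mul_left a 1).tdiff]
    simp only [mul_smul]
    rw [formAt_pullback_comp (g := fun y : MulAction.orbit G p => a • y)
      (smoothAt_smul EG E a _).tdiff (smoothAt_orbitMap (E := E) x _).tdiff,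
      pullback_smul_orbitForm hO hα hτ]
  · rw [formAt_pullback_apply, one_smul, ← hα]
    congr 1
    funext i
    fin_cases i <;> rfl

/-- The construction chose sections pointwise, so smoothness is not built in. It descends along the
orbit map, a submersion, from a left-invariant form. -/
theorem isSmoothForm_orbitForm [FiniteDimensional ℝ EG] [FiniteDimensional ℝ E] :
    IsSmoothForm α := by
  refine isSmoothForm_iff.2 fun x => ?_
  obtain ⟨g, rfl⟩ := orbitMap_surjective x
  refine smoothFormAt_of_pullback hO ?_
  obtain ⟨A, hA, -⟩ := pullback_orbitForm hO hα hτ (orbitMap G p 1)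
  rw [orbitMap_eq, hA]
  exact smoothFormAt_leftForm A g

theorem formAt_extD_orbitForm [FiniteDimensional ℝ EG] [FiniteDimensional ℝ E]
    (x : MulAction.orbit G p) (ξ η ζ : EG) :
    formAt (extD α) x ![fund G E x ξ, fund G E x η, fund G E x ζ] =
      -tauForm (G := G) τ (x : P) (lieB G ξ η) ζ + tauForm (G := G) τ (x : P) (lieB G ξ ζ) η -
        tauForm (G := G) τ (x : P) (lieB G η ζ) ξ := by
  have := contMDiffSMul_orbit hO
  obtain ⟨A, hA, hA'⟩ := pullback_orbitForm hO hα hτ x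
  have h1 := formAt_extD_pullback (x := (1 : G)) (f := fun g : G => g • x)
    (isSmoothForm_iff.1 (isSmoothForm_orbitForm hO hα hτ) _) (smoothAt_orbitMap (EG := EG) (E := E) x 1)
  rw [hA] at h1
  have h2 := DFunLike.congr_fun h1 ![ξ, η, ζ]
  have h3 := formAt_extD_leftForm_two A (1 : G) ξ η ζ
  simp only [lmul_one, hA'] at h3
  rw [← h3, h2, formAt_pullback_apply, one_smul]
  congr 1
  funext i
  fin_cases i <;> rfl

end

theorem formAt_pullback_val_one (β : DiffForm EP P 1) (x : MulAction.orbit G p) (ξ : EG) :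
    formAt (pullback (Subtype.val : MulAction.orbit G p → P) β) x ![fund G E x ξ] =
      formAt β (x : P) ![fund G EP (x : P) ξ] := by
  rw [formAt_pullback_apply]
  congr 1
  funext i
  fin_cases i
  exact tderiv_val_fund hO x ξ

theorem formAt_pullback_val_three (β : DiffForm EP P 3) (x : MulAction.orbit G p) (ξ η ζ : EG) :
    formAt (pullback (Subtype.val : MulAction.orbit G p → P) β) x
      ![fund G E x ξ, fund G E x η, fund G E x ζ] =
      formAt β (x : P) ![fund G EP (x : P) ξ, fund G EP (x : P) η, fund G EP (x : P) ζ] := by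
  rw [formAt_pullback_apply]
  congr 1
  funext i
  fin_cases i
  · exact tderiv_val_fund hO x ξ
  · exact tderiv_val_fund hO x η
  · exact tderiv_val_fund hO x ζ

variable {α : DiffForm E (MulAction.orbit G p) 2}
  (hα : ∀ x ξ η, formAt α x ![fund G E x ξ, fund G E x η] = tauForm (G := G) τ (x : P) ξ η)
include hα

theorem orbitForm_fund (ξ : EG) (x : MulAction.orbit G p) (v : E) :
    formAt α x ![fund G E x ξ, v] =
      formAt (pullback (Subtype.val : MulAction.orbit G p → P) (τ ξ)) x ![v] := by
  obtain ⟨η, rfl⟩ := exists_fund_eq hO x v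
  rw [hα, tauForm_apply, formAt_pullback_val_one hO]

theorem extD_orbitForm [FiniteDimensional ℝ EG] [FiniteDimensional ℝ E] {Ξ : DiffForm EP P 3}
    (hτ : ∀ (g : G) ξ, τ (adE EG g ξ) = pullback (fun x : P => g⁻¹ • x) (τ ξ))
    (hd : ∀ (x : P) (ξ η ζ : EG),
      formAt Ξ x ![fund G EP x ξ, fund G EP x η, fund G EP x ζ] =
        -(-tauForm (G := G) τ x (lieB G ξ η) ζ + tauForm (G := G) τ x (lieB G ξ ζ) η -
          tauForm (G := G) τ x (lieB G η ζ) ξ)) :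
    extD α = -pullback (Subtype.val : MulAction.orbit G p → P) Ξ := by
  refine formAt_ext fun x => ?_
  ext v
  obtain ⟨ξ, hξ⟩ := exists_fund_eq hO x (v 0)
  obtain ⟨η, hη⟩ := exists_fund_eq hO x (v 1)
  obtain ⟨ζ, hζ⟩ := exists_fund_eq hO x (v 2)
  have e : v = ![fund G E x ξ, fund G E x η, fund G E x ζ] := by
    rw [hξ, hη, hζ]; funext i; fin_cases i <;> rfl
  have h1 := formAt_pullback_val_three hO Ξ x ξ η ζ
  rw [hd] at h1
  rw [e, formAt_extD_orbitForm hO hα hτ]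
  exact neg_eq_iff_eq_neg.1 h1.symm

theorem ker_orbitForm [FiniteDimensional ℝ EG] [IsManifold 𝓘(ℝ, EP) ∞ P]
    (hker : ∀ (x : P) (ξ : EG), (∀ η, tauForm (G := G) τ x ξ η = 0) →
      ∃ ξ', formAt (τ ξ') x = 0 ∧ fund G EP x ξ = fund G EP x ξ')
    (x : MulAction.orbit G p) (v : E) :
    (∀ w, formAt α x ![v, w] = 0) ↔ ∃ ξ, formAt (τ ξ) (x : P) = 0 ∧ v = fund G E x ξ := by
  constructor
  · intro hv
    obtain ⟨ξ, rfl⟩ := exists_fund_eq hO x v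
    -- `ξ` itself need not lie in the kernel of `τ`; it may be altered by elements whose fundamental
    -- vector vanishes at the point.
    obtain ⟨ξ', h0, h1⟩ := hker x ξ fun η => (hα x ξ η).symm.trans (hv _)
    refine ⟨ξ', h0, ?_⟩
    have h2 := fund_orbit_eq_zero (EP := EP) hO x (ξ := ξ - ξ')
      (by rw [ContinuousLinearMap.map_sub, h1, sub_self])
    rwa [map_sub, sub_eq_zero] at h2
  · rintro ⟨ξ, h0, rfl⟩ w
    obtain ⟨η, rfl⟩ := exists_fund_eq hO x w
    rw [hα, tauForm_apply, h0]
    rfl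

end Orbit

/-- A criterion for a premoment space to be a moment space. -/
theorem IsPremomentSpace.isMomentSpace
    {EG : Type*} [NormedAddCommGroup EG] [NormedSpace ℝ EG] [FiniteDimensional ℝ EG]
    {G : Type*} [TopologicalSpace G] [ChartedSpace EG G] [Group G] [LieGroup 𝓘(ℝ, EG) ∞ G]
    {EP : Type*} [NormedAddCommGroup EP] [NormedSpace ℝ EP]
    {P : Type*} [TopologicalSpace P] [ChartedSpace EP P] [MulAction G P]
    {Ξ : DiffForm EP P 3} {τ : EG →ₗ[ℝ] DiffForm EP P 1}
    (hpre : IsPremomentSpace (G := G) Ξ (τ : GroupLieAlgebra 𝓘(ℝ, EG) G →ₗ[ℝ] DiffForm EP P 1))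
    (hd : ∀ (x : P) (ξ η ζ : EG),
      formAt Ξ x ![fund G EP x ξ, fund G EP x η, fund G EP x ζ] =
        -(-tauForm (G := G) τ x (lieB G ξ η) ζ + tauForm (G := G) τ x (lieB G ξ ζ) η -
          tauForm (G := G) τ x (lieB G η ζ) ξ))
    (hker : ∀ (x : P) (ξ : EG), (∀ η, tauForm (G := G) τ x ξ η = 0) →
      ∃ ξ', formAt (τ ξ') x = 0 ∧ fund G EP x ξ = fund G EP x ξ') :
    IsMomentSpace (G := G) Ξ (τ : GroupLieAlgebra 𝓘(ℝ, EG) G →ₗ[ℝ] DiffForm EP P 1) where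
  toIsPremomentSpace := hpre
  orbit_hamiltonian p n _ _ _ hO := by
    have := hpre.isManifold
    have := hpre.smooth_action
    have := contMDiffSMul_orbit hO
    obtain ⟨α, hα⟩ := exists_orbitForm (τ := τ) hO hpre.closed₃
    have hτ : ∀ (g : G) (ξ : EG), τ (adE EG g ξ) = pullback (fun x : P => g⁻¹ • x) (τ ξ) :=
      hpre.equivariant
    refine ⟨α, ⟨hα, ?_⟩, fun β hβ => orbit_formAt_ext hO fun x ξ η =>
      Eq.trans (hβ.1 x ξ η) (hα x ξ η).symm⟩
    refine ⟨⟨inferInstance, inferInstance, isSmoothForm_orbitForm hO hα hτ,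
      fun x => smoothAt_orbit_val hO x, pullback_smul_orbitForm hO hα hτ, fun g x => rfl,
      extD_orbitForm hO hα hτ hd, orbitForm_fund hO hα⟩, fun x => ?_⟩
    exact Set.ext (ker_orbitForm hO hα hker x)

/-! ### The moment space conditions for H/G -/

section Main
variable {EH : Type*} [NormedAddCommGroup EH] [NormedSpace ℝ EH] [FiniteDimensional ℝ EH]
  {EG : Type*} [NormedAddCommGroup EG] [NormedSpace ℝ EG] [FiniteDimensional ℝ EG]
  {EP : Type*} [NormedAddCommGroup EP] [NormedSpace ℝ EP]
  {H : Type*} [TopologicalSpace H] [ChartedSpace EH H] [Group H] [LieGroup 𝓘(ℝ, EH) ∞ H]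
  {G : Subgroup H} [ChartedSpace EG G] [ChartedSpace EP (H ⧸ G)]
  {σ : H →* H} {Λ : EH →ₗ[ℝ] EH →ₗ[ℝ] ℝ}
  [LieGroup 𝓘(ℝ, EG) ∞ G] [IsManifold 𝓘(ℝ, EP) ∞ (H ⧸ G)]
  (hG : Manifold.IsSmoothEmbedding 𝓘(ℝ, EG) 𝓘(ℝ, EH) ∞ (Subtype.val : G → H))
  (hP : Manifold.IsSubmersion 𝓘(ℝ, EH) 𝓘(ℝ, EP) ∞ (QuotientGroup.mk : H → H ⧸ G))
  (hσ : IsSymmetricPair EH σ G) (D : LegendrianData H (invDiff EH σ) Λ)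
include hG hP hσ D

omit [FiniteDimensional ℝ EG] [LieGroup 𝓘(ℝ, EG) ∞ G] in
theorem tauForm_induced (h : H) (ξ η : EG) :
    tauForm (EG := EG) (G := G) (inducedOne EG EP G σ Λ) (QuotientGroup.mk h) ξ η =
      Λ (adE EH h⁻¹ (inc EH EG G ξ)) (proj (invDiff EH σ) (adE EH h⁻¹ (inc EH EG G η))) := by
  rw [← D.Ad_invariant']
  exact formAt_inducedOne_fund hG hP hσ ξ η h

theorem inducedThree_fund_fund_fund (x : H ⧸ G) (ξ η ζ : EG) :
    formAt (inducedThree EP G σ D) x ![fund G EP x ξ, fund G EP x η, fund G EP x ζ] =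
      -(-tauForm (EG := EG) (G := G) (inducedOne EG EP G σ Λ) x (lieB G ξ η) ζ +
        tauForm (EG := EG) (G := G) (inducedOne EG EP G σ Λ) x (lieB G ξ ζ) η -
        tauForm (EG := EG) (G := G) (inducedOne EG EP G σ Λ) x (lieB G η ζ) ξ) := by
  obtain ⟨h, rfl⟩ := QuotientGroup.mk_surjective x
  rw [fund_mk hG hP, fund_mk hG hP, fund_mk hG hP, formAt_inducedThree hP hσ D,
    tauForm_induced hG hP hσ D, tauForm_induced hG hP hσ D, tauForm_induced hG hP hσ D,
    inc_lieB hG, inc_lieB hG, inc_lieB hG, adE_lieB, adE_lieB, adE_lieB, D.cocycle]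
  -- The hypothesis of `cocycle`: the three vectors lie in `Ad_{h⁻¹} 𝔤`, a subalgebra isotropic for
  -- `Λ`.
  rw [← adE_lieB, ← D.Ad_invariant', adE_adE_inv, ← inc_lieB hG]
  exact D.isotropic (invDiff_inc hG hσ _) (invDiff_inc hG hσ _)

/-- The key to minimal degeneracy: the `𝔭`-part of `Ad_{h⁻¹} ξ` turns out to lie in `Ad_{h⁻¹} 𝔤`. An
element of `𝔤` representing it generates the same tangent vector as `ξ` and is annihilated by `τ`,
since `𝔭` is isotropic. -/
theorem exists_tau_eq_zero_of_tauForm_eq_zero (x : H ⧸ G) (ξ : EG)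
    (hξ : ∀ η, tauForm (EG := EG) (G := G) (inducedOne EG EP G σ Λ) x ξ η = 0) :
    ∃ ξ' : EG, formAt (inducedOne EG EP G σ Λ ξ') x = 0 ∧ fund G EP x ξ = fund G EP x ξ' := by
  obtain ⟨h, rfl⟩ := QuotientGroup.mk_surjective x
  set a := adE EH h⁻¹ (inc EH EG G ξ) with ha
  -- For `b = Ad_{h⁻¹} η` the hypothesis says `Λ(a, b - s b) = 0`. Since also `Λ(a, b) = 0`,
  -- skewness gives `Λ(s a, b) = 0`, so `Ad_h (s a)` is orthogonal to `𝔤` and is therefore fixed by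
  -- `s`.
  have hw : invDiff EH σ (adE EH h (invDiff EH σ a)) = adE EH h (invDiff EH σ a) := by
    refine D.fixed_of_orthogonal fun y hy => ?_
    obtain ⟨η, rfl⟩ := exists_inc_eq hG hσ hy
    have h1 := hξ η
    rw [tauForm_induced hG hP hσ D, ← ha] at h1
    have h2 : Λ a (adE EH h⁻¹ (inc EH EG G η)) = 0 := by
      rw [ha, ← D.Ad_invariant', adE_adE_inv]
      exact D.isotropic (invDiff_inc hG hσ _) (invDiff_inc hG hσ _)
    simp only [proj, map_smul, map_sub, h2, smul_eq_mul] at h1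
    rw [D.Ad_invariant, D.skew]
    linarith
  obtain ⟨ξ₁, hξ₁⟩ := exists_inc_eq hG hσ hw
  have ha' : adE EH h⁻¹ (inc EH EG G ((1 / 2 : ℝ) • (ξ - ξ₁))) = proj (invDiff EH σ) a := by
    simp only [map_smul, map_sub, hξ₁, adE_inv_adE]
    rfl
  refine ⟨(1 / 2 : ℝ) • (ξ - ξ₁), ?_, ?_⟩
  · ext v
    obtain ⟨y, hy⟩ := exists_quotDiff_eq hP h (v 0)
    have e : v = ![quotDiff EH EP G h y] := by
      rw [hy]; funext i; fin_cases i; rfl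
    rw [e, formAt_inducedOne hP hσ, D.Ad_invariant', ha',
      D.isotropic_neg (D.map_proj _) (D.map_proj _)]
    rfl
  · rw [fund_mk hG hP, fund_mk hG hP, ha', ← ha, ← sub_eq_zero, ← map_sub]
    exact quotDiff_eq_zero hG hP hσ h (D.map_sub_proj a)

theorem isMomentSpace_induced [FiniteDimensional ℝ EP] :
    IsMomentSpace (inducedThree EP G σ D) (inducedOne EG EP G σ Λ) :=
  (isPremomentSpace_induced hG hP hσ D).isMomentSpace
    (inducedThree_fund_fund_fund hG hP hσ D) (exists_tau_eq_zero_of_tauForm_eq_zero hG hP hσ D)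

end Main

end MomentSpace

end

/-- Let `(H, G)` be a Legendrian symmetric pair, and give `P = H/G` the manifold structure for which
the quotient map `H → H/G` is a submersion. There are unique forms `Ξ` and `τ` on `P` with
`j^* Ξ = (1/3) Λ(π, [π, π])` and `j^* τ(ξ) = Λ(ξ, Ad_h π)`, and `(P, Ξ + τ)` is a moment space
for `G`. -/
theorem mainTheorem2
    {EH : Type*} [NormedAddCommGroup EH] [NormedSpace ℝ EH] [FiniteDimensional ℝ EH]
    {EG : Type*} [NormedAddCommGroup EG] [NormedSpace ℝ EG] [FiniteDimensional ℝ EG]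
    {EP : Type*} [NormedAddCommGroup EP] [NormedSpace ℝ EP] [FiniteDimensional ℝ EP]
    {H : Type*} [TopologicalSpace H] [ChartedSpace EH H] [Group H] [LieGroup 𝓘(ℝ, EH) ∞ H]
    (G : Subgroup H) [ChartedSpace EG G] [LieGroup 𝓘(ℝ, EG) ∞ G]
    (hG : Manifold.IsSmoothEmbedding 𝓘(ℝ, EG) 𝓘(ℝ, EH) ∞ (Subtype.val : G → H))
    [ChartedSpace EP (H ⧸ G)] [IsManifold 𝓘(ℝ, EP) ∞ (H ⧸ G)]
    (hP : Manifold.IsSubmersion 𝓘(ℝ, EH) 𝓘(ℝ, EP) ∞ (QuotientGroup.mk : H → H ⧸ G))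
    (σ : H →* H) (hσ : MomentSpace.IsSymmetricPair EH σ G)
    (Λ : LinearMap.BilinForm ℝ (GroupLieAlgebra 𝓘(ℝ, EH) H))
    (hΛ : MomentSpace.IsLegendrianStructure σ Λ) :
    (∃! F : MomentSpace.DiffForm EP (H ⧸ G) 3 ×
        (GroupLieAlgebra 𝓘(ℝ, EG) G →ₗ[ℝ] MomentSpace.DiffForm EP (H ⧸ G) 1),
      MomentSpace.IsInduced σ Λ F.1 F.2) ∧
    ∀ (Ξ : MomentSpace.DiffForm EP (H ⧸ G) 3)
      (τ : GroupLieAlgebra 𝓘(ℝ, EG) G →ₗ[ℝ] MomentSpace.DiffForm EP (H ⧸ G) 1),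
      MomentSpace.IsInduced σ Λ Ξ τ → MomentSpace.IsMomentSpace Ξ τ := by
  have D := hσ.legendrianData (Λ := (Λ : EH →ₗ[ℝ] EH →ₗ[ℝ] ℝ)) hΛ
  have h0 := MomentSpace.isInduced_induced (EG := EG) hP hσ D
  refine ⟨⟨(_, _), h0, fun F hF => ?_⟩, fun Ξ τ h => ?_⟩
  · obtain ⟨h1, h2⟩ := hF.unique hP h0
    exact Prod.ext h1 h2
  · obtain ⟨rfl, rfl⟩ := h.unique hP h0
    exact MomentSpace.isMomentSpace_induced hG hP hσ D
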